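/- **Corollary 5.3.** Let $p$ be an odd prime and let $a=\pm\prod_{j=1}^m q_j^{e_j}$ with distinct primes $q_1,\dots,q_m$ and $1\le e_j\le p-1$. Let $K=\mathbb{Q}(\alpha)$ with $\alpha^p=a$, and let $\mathcal{O}_K$ be its ring of integers. For $1\le j\le m$ let $1\le u_j\le p-1$ and $v_j\ge 0$ be the integers with $e_ju_j-pv_j=1$, and put $$c_j=\frac{a^{u_j}}{q_j^{pv_j}}\in\mathbb{Z},\qquad \gamma_j=\frac{\alpha^{u_j}}{q_j^{v_j}}\in K,\qquad \beta_j'=\frac{(\gamma_j-c_j)^{p-1}}{p}\in K.$$ Products of subrings of $K$ are the additive groups generated by the products of their elements, $\operatorname{disc}$ of a subring that is free of rank $p$ over $\mathbb{Z}$ is the discriminant of any of its $\mathbb{Z}$-bases, and greatest common divisors in $\mathbb{Z}$ are understood up to sign. Assume that $p$ is a Wieferich prime to base $a$, i.e. $p^2\mid a^{p-1}-1$. Then for every $1\le i\le m$: 1. $\mathcal{O}_K=\mathbb{Z}[\beta_i']\cdot\prod_{j=1}^m\mathbb{Z}[\gamma_j]$. 2. $\operatorname{disc}(\mathcal{O}_K)=(-1)^{\frac{p-1}{2}}\,p^{\,p-2}\prod_{j=1}^m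 q_j^{p-1}$. 3. If $p\ge 5$, then $\mathbb{Z}[\beta_i']$ and all $\mathbb{Z}[\gamma_j]$ are free of rank $p$ over $\mathbb{Z}$, and $\operatorname{disc}(\mathcal{O}_K)=\gcd\bigl(\operatorname{disc}(\mathbb{Z}[\beta_i']),\operatorname{disc}(\mathbb{Z}[\gamma_1]),\dots,\operatorname{disc}(\mathbb{Z}[\gamma_m])\bigr)$. 4. For every odd $p$ (including $p=3$), all $\mathbb{Z}[\beta_i']\cdot\mathbb{Z}[\gamma_j]$ are free of rank $p$ over $\mathbb{Z}$, and $\operatorname{disc}(\mathcal{O}_K)=\gcd\bigl(\operatorname{disc}(\mathbb{Z}[\beta_i']\cdot\mathbb{Z}[\gamma_j]);\ 1\le j\le m\bigr)$. -/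

import Mathlib

/-- `q` is a Wieferich prime to base `r`: `q ^ 2` divides `r ^ (q - 1) - 1`
(used only for primes `q` and integers `r` different from `0`, `1` and `-1`). -/
def IsWieferich (q : ℕ) (r : ℤ) : Prop :=
  (q : ℤ) ^ 2 ∣ r ^ (q - 1) - 1

/-- The subring `ℤ[x]` of `K`, as a `ℤ`-submodule. For such submodules, `*` and `∏` are the
products of the paper: the additive groups generated by the products of elements. -/
def intAdjoin {K : Type*} [Field K] (x : K) : Submodule ℤ K :=
  Subalgebra.toSubmodule (Algebra.adjoin ℤ {x})

/-- The ring of integers of `K`, as a `ℤ`-submodule of `K`. -/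
def ringOfIntegersSubmodule (K : Type*) [Field K] : Submodule ℤ K :=
  Subalgebra.toSubmodule (integralClosure ℤ K)

/-- The `ℤ`-submodule `M` of the number field `K` is free of rank `[K : ℚ]`, and the
discriminant (determinant of the trace matrix) of a `ℤ`-basis of `M` is the integer `d`. -/
def HasDiscr {K : Type*} [Field K] [NumberField K] (M : Submodule ℤ K) (d : ℤ) : Prop :=
  ∃ b : Module.Basis (Fin (Module.finrank ℚ K)) ℤ M,
    Algebra.discr ℚ (fun k => (b k : K)) = (d : ℚ)

/-- The discriminant does not depend on the choice of the `ℤ`-basis. -/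
theorem HasDiscr.unique {K : Type*} [Field K] [NumberField K] {M : Submodule ℤ K} {d d' : ℤ}
    (h : HasDiscr M d) (h' : HasDiscr M d') : d = d' := by
  obtain ⟨b, hb⟩ := h
  obtain ⟨b', hb'⟩ := h'
  have key : (fun k => (b' k : K)) =
      Matrix.vecMul (fun k => (b k : K))
        (((b.toMatrix b').map (Int.cast : ℤ → ℚ)).map (algebraMap ℚ K)) := by
    funext k
    have h1 := congrArg (Subtype.val : M → K) (b.sum_toMatrix_smul_self b' k)
    rw [← h1]
    simp only [Matrix.vecMul, dotProduct, Matrix.map_apply, Submodule.coe_sum,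
      Submodule.coe_smul, zsmul_eq_mul, map_intCast, mul_comm]
  have hdet : ((b.toMatrix b').map (Int.cast : ℤ → ℚ)).det = ((b.toMatrix b').det : ℚ) :=
    (Int.cast_det _).symm
  have hu : IsUnit (b.toMatrix b').det := by
    have hm : (b.toMatrix b') * (b'.toMatrix b) = 1 := b.toMatrix_mul_toMatrix_flip b'
    have := congrArg Matrix.det hm
    rw [Matrix.det_mul, Matrix.det_one] at this
    exact IsUnit.of_mul_eq_one _ this
  have hsq : (b.toMatrix b').det ^ 2 = 1 := by
    rcases Int.isUnit_iff.mp hu with h | h <;> simp [h]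
  have h2 : Algebra.discr ℚ (fun k => (b' k : K)) = Algebra.discr ℚ (fun k => (b k : K)) := by
    rw [key, Algebra.discr_of_matrix_vecMul, hdet]
    have : ((b.toMatrix b').det : ℚ) ^ 2 = 1 := by exact_mod_cast hsq
    rw [this, one_mul]
  rw [hb, hb'] at h2
  exact_mod_cast h2.symm

/-- The integer `c = a ^ u / q ^ (p v)`, regarded as an element of `K`. -/
def radC (K : Type*) [Field K] (p : ℕ) (a : ℤ) (q u v : ℕ) : K :=
  (a : K) ^ u / (q : K) ^ (p * v)

/-- The element `γ = α ^ u / q ^ v`, a `p`-th root of `c`. -/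
def radGamma {K : Type*} [Field K] (α : K) (q u v : ℕ) : K :=
  α ^ u / (q : K) ^ v

/-- The element `(γ - c) ^ (p - 1) / p`. -/
def radBeta {K : Type*} [Field K] (p : ℕ) (a : ℤ) (α : K) (q u v : ℕ) : K :=
  (radGamma α q u v - radC K p a q u v) ^ (p - 1) / (p : K)

/-! Everything is decided one prime at a time. The element `γ_j` is a root of `X ^ p - c_j` with
`c_j = q_j g_j` and `q_j ∤ g_j`, a polynomial that is Eisenstein at `q_j` and has discriminant `± p
^ p c_j ^ (p - 1)`. Hence `ℤ[γ_j]` is maximal at every prime `ℓ ≠ p` not dividing `g_j`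
(`smul_mem_adjoin_of_eisenstein`), and no prime divides all the `g_j`.

At `p`, put `π = γ - c` and `β = π ^ (p - 1) / p`. Expanding `(π + c) ^ p = c` and using `c ^ (p -
1) ≡ 1` mod `p ^ 2` gives formulas for `β π` and `β ^ 2` (`exists_mul_relations`). So `β` is
integral and `ℤ[β, γ] = ℤ[γ] + ℤ β`, which is maximal at `p` by a trace argument: traces from `ℤ[γ]`
lie in `pℤ`, while `β` has trace `≡ 1` mod `p` (`mem_adjoin_of_mul_mem`). The decomposition of the
ring of integers follows by gluing (`LocallyLE.le_of_forall`).

For discriminants, a sublattice has discriminant `k ^ 2 disc K`, with `k` prime to each `ℓ` at which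
the sublattice is maximal (`exists_hasDiscr_of_locallyLE`). A family with a maximal member at every
prime therefore has gcd `disc K`. This gives both gcd formulas, and also the value of `disc K`,
since `disc ℤ[β_j, γ_j]` is computed explicitly. For `p ≥ 5`, `β` alone already generates at `p`
(`locallyLE_adjoin_beta`). -/

/-- `M` is contained in `N` after localization at `ℓ`. -/
def LocallyLE {K : Type*} [Field K] (ℓ : ℕ) (M N : Submodule ℤ K) : Prop :=
  ∀ x ∈ M, ∃ n : ℤ, ¬ (ℓ : ℤ) ∣ n ∧ n • x ∈ N

/-! ### Containment of lattices at a single prime -/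

namespace LocallyLE

variable {K : Type*} [Field K] {ℓ : ℕ} {M N P : Submodule ℤ K}

theorem trans (hℓ : ℓ.Prime) (h : LocallyLE ℓ M N) (h' : LocallyLE ℓ N P) :
    LocallyLE ℓ M P := by
  intro x hx
  obtain ⟨n, hn, hnx⟩ := h x hx
  obtain ⟨k, hk, hkx⟩ := h' _ hnx
  refine ⟨k * n, fun hd => ?_, by rwa [mul_smul]⟩
  exact ((Nat.prime_iff_prime_int.mp hℓ).dvd_or_dvd hd).elim hk hn

theorem mono_right (h : LocallyLE ℓ M N) (hNP : N ≤ P) : LocallyLE ℓ M P := fun x hx =>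
  let ⟨n, hn, hnx⟩ := h x hx
  ⟨n, hn, hNP hnx⟩

theorem exists_uniform (hℓ : ℓ.Prime) (h : LocallyLE ℓ M N) (hM : M.FG) :
    ∃ n : ℤ, ¬ (ℓ : ℤ) ∣ n ∧ ∀ x ∈ M, n • x ∈ N := by
  obtain ⟨S, rfl⟩ := hM
  choose f hf hfN using h
  classical
  let g : K → ℤ := fun x => if hx : x ∈ Submodule.span ℤ (S : Set K) then f x hx else 1
  refine ⟨∏ x ∈ S, g x, ?_, ?_⟩
  · rw [(Nat.prime_iff_prime_int.mp hℓ).dvd_finsetProd_iff]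
    rintro ⟨x, hx, hd⟩
    have hx' : x ∈ Submodule.span ℤ (S : Set K) := Submodule.subset_span hx
    simp only [g, dif_pos hx'] at hd
    exact hf x hx' hd
  · intro x hx
    induction hx using Submodule.span_induction with
    | mem x hx =>
      have hx' : x ∈ Submodule.span ℤ (S : Set K) := Submodule.subset_span hx
      rw [← Finset.prod_erase_mul S g hx, mul_smul]
      refine N.smul_mem _ ?_
      simp only [g, dif_pos hx']
      exact hfN x hx'
    | zero => simp
    | add x y _ _ hx hy => rw [smul_add]; exact N.add_mem hx hy
    | smul r x _ hx => rw [smul_comm]; exact N.smul_mem _ hx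

/-- A module that is locally contained in `N` at every prime is contained in `N`. -/
theorem le_of_forall (h : ∀ ℓ : ℕ, ℓ.Prime → LocallyLE ℓ M N) : M ≤ N := by
  intro x hx
  let I : Ideal ℤ := (⊥ : Submodule ℤ (K ⧸ N)).comap (LinearMap.toSpanSingleton ℤ _ (N.mkQ x))
  have hI : ∀ n : ℤ, n ∈ I ↔ n • x ∈ N := by
    intro n
    simp only [I, Submodule.mem_comap, LinearMap.toSpanSingleton_apply, Submodule.mem_bot,
      ← map_smul]
    simp
  obtain ⟨d, hd⟩ := (IsPrincipalIdealRing.principal I).principal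
  have hd' : ∀ n, n ∈ I ↔ d ∣ n := fun n => by rw [hd]; exact Ideal.mem_span_singleton
  have h1 : d.natAbs = 1 := by
    by_contra hne
    obtain ⟨ℓ, hℓ, hdvd⟩ := Nat.exists_prime_and_dvd hne
    obtain ⟨n, hn, hnx⟩ := h ℓ hℓ x hx
    exact hn ((Int.natCast_dvd.mpr hdvd).trans ((hd' n).mp ((hI n).mpr hnx)))
  have := (hI 1).mp ((hd' 1).mpr (Int.natAbs_dvd.mp (by simp [h1])))
  simpa using this

end LocallyLE

/-! ### Discriminants of sublattices of the ring of integers -/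

section

variable {K : Type*} [Field K] [NumberField K]

theorem ringOfIntegersSubmodule_fg : (ringOfIntegersSubmodule K).FG :=
  Module.Finite.iff_fg.mp (inferInstanceAs (Module.Finite ℤ (NumberField.RingOfIntegers K)))

theorem discr_comp_equiv {ι ι' : Type*} [Fintype ι] [DecidableEq ι] [Fintype ι'] [DecidableEq ι']
    (b : ι → K) (e : ι' ≃ ι) : Algebra.discr ℚ (b ∘ e) = Algebra.discr ℚ b := by
  rw [Algebra.discr_def, Algebra.discr_def, ← Matrix.det_submatrix_equiv_self e]
  rfl

theorem hasDiscr_of_span {ι : Type*} [Fintype ι] [DecidableEq ι]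
    (hι : Fintype.card ι = Module.finrank ℚ K) {b : ι → K} {d : ℤ}
    (hb : Algebra.discr ℚ b = d) (hd : d ≠ 0) {M : Submodule ℤ K}
    (hM : Submodule.span ℤ (Set.range b) = M) : HasDiscr M d := by
  subst hM
  have hli : LinearIndependent ℚ b := by
    by_contra h
    exact hd (by exact_mod_cast hb.symm.trans (Algebra.discr_zero_of_not_linearIndependent ℚ h))
  have hli' : LinearIndependent ℤ b :=
    hli.restrict_scalars (fun x y h => by simpa using h)
  let e : ι ≃ Fin (Module.finrank ℚ K) := Fintype.equivFinOfCardEq hι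
  refine ⟨(Module.Basis.span hli').reindex e, ?_⟩
  rw [← hb, ← discr_comp_equiv b e.symm]
  congr 1
  funext k
  simp [Module.Basis.span_apply]

/-- Submodules of finite index in the ring of integers have a discriminant; its cofactor is the
square of an integer that is prime to every prime at which the submodule is maximal. -/
theorem exists_hasDiscr_of_locallyLE {M : Submodule ℤ K} (hM : M ≤ ringOfIntegersSubmodule K)
    {ℓ₀ : ℕ} (hℓ₀ : ℓ₀.Prime) (h₀ : LocallyLE ℓ₀ (ringOfIntegersSubmodule K) M) :
    ∃ k : ℤ, HasDiscr M (k ^ 2 * NumberField.discr K) ∧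
      ∀ ℓ : ℕ, ℓ.Prime → LocallyLE ℓ (ringOfIntegersSubmodule K) M → ¬ (ℓ : ℤ) ∣ k := by
  classical
  have hcard : Fintype.card (Module.Free.ChooseBasisIndex ℤ (NumberField.RingOfIntegers K)) =
      Module.finrank ℚ K := by
    rw [← Module.finrank_eq_card_chooseBasisIndex, NumberField.RingOfIntegers.rank]
  let e := Fintype.equivFinOfCardEq hcard
  let B : Module.Basis (Fin (Module.finrank ℚ K)) ℤ (ringOfIntegersSubmodule K) :=
    (NumberField.RingOfIntegers.basis K).reindex e
  have hB : Algebra.discr ℚ (fun k => (B k : K)) = NumberField.discr K := by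
    rw [NumberField.coe_discr, ← Algebra.discr_reindex ℚ _ e]
    congr 1
    funext k
    rw [Function.comp_apply, NumberField.integralBasis_apply]
    exact congrArg (algebraMap (NumberField.RingOfIntegers K) K)
      (Module.Basis.reindex_apply (NumberField.RingOfIntegers.basis K) e k)
  have : Module.Free ℤ (ringOfIntegersSubmodule K) := Module.Free.of_basis B
  have : Module.Finite ℤ (ringOfIntegersSubmodule K) := Module.Finite.of_basis B
  let i : M →ₗ[ℤ] ringOfIntegersSubmodule K := Submodule.inclusion hM
  have hmul : ∀ ℓ : ℕ, ℓ.Prime → LocallyLE ℓ (ringOfIntegersSubmodule K) M →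
      ∃ (n : ℤ) (f : ringOfIntegersSubmodule K →ₗ[ℤ] M), ¬ (ℓ : ℤ) ∣ n ∧
        i ∘ₗ f = n • LinearMap.id := by
    intro ℓ hℓ h
    obtain ⟨n, hn, hnM⟩ := h.exists_uniform hℓ ringOfIntegersSubmodule_fg
    refine ⟨n, LinearMap.codRestrict M (n • (ringOfIntegersSubmodule K).subtype)
      (fun x => hnM x x.2), hn, ?_⟩
    ext x
    simp only [LinearMap.smul_apply, LinearMap.id_apply, Submodule.coe_smul]
    rfl
  have : Module.Finite ℤ M := Module.Finite.of_injective i (Submodule.inclusion_injective hM)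
  have : Module.Free ℤ M := Module.free_of_finite_type_torsion_free'
  have hrank : Module.finrank ℤ M = Module.finrank ℚ K := by
    have hO : Module.finrank ℤ (ringOfIntegersSubmodule K) = Module.finrank ℚ K := by
      simpa using Module.finrank_eq_card_basis B
    refine le_antisymm (hO ▸ Submodule.finrank_mono hM) ?_
    rw [← hO]
    -- Multiplication by a nonzero `n` on the ring of integers factors through `M`, which forces
    -- full rank. One prime is enough for this.
    obtain ⟨n, f, hn, hf⟩ := hmul ℓ₀ hℓ₀ h₀
    refine LinearMap.finrank_le_finrank_of_injective (f := f) (fun x y hxy => ?_)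
    have := congrArg i hxy
    rw [← LinearMap.comp_apply, ← LinearMap.comp_apply, hf] at this
    simp only [LinearMap.smul_apply, LinearMap.id_apply] at this
    have hn0 : n ≠ 0 := by rintro rfl; exact hn (dvd_zero _)
    have h2 := congrArg (Subtype.val : ringOfIntegersSubmodule K → K) this
    simp only [Submodule.coe_smul] at h2
    exact Subtype.ext (smul_right_injective K hn0 h2)
  let b : Module.Basis (Fin (Module.finrank ℚ K)) ℤ M := Module.finBasisOfFinrankEq ℤ M hrank
  let A := LinearMap.toMatrix b B i
  refine ⟨A.det, ⟨b, ?_⟩, ?_⟩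
  · have key : (fun k => (b k : K)) = Matrix.vecMul (fun k => (B k : K))
        ((A.map (Int.cast : ℤ → ℚ)).map (algebraMap ℚ K)) := by
      funext k
      have h1 := congrArg (Subtype.val : ringOfIntegersSubmodule K → K) (B.sum_repr (i (b k)))
      change _ = (b k : K) at h1
      rw [← h1]
      simp only [Matrix.vecMul, dotProduct, Matrix.map_apply, Submodule.coe_sum, A,
        LinearMap.toMatrix_apply, Submodule.coe_smul, zsmul_eq_mul, map_intCast, mul_comm]
    have hdet : (A.map (Int.cast : ℤ → ℚ)).det = (A.det : ℚ) := (Int.cast_det _).symm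
    rw [key, Algebra.discr_of_matrix_vecMul, hdet, hB]
    push_cast
    rfl
  -- Multiplication by `n` factors through the inclusion, so `A.det` divides a power of `n`, and `ℓ
  -- ∤ n`.
  · intro ℓ hℓ h hdvd
    obtain ⟨n, f, hn, hf⟩ := hmul ℓ hℓ h
    have hcomp := LinearMap.toMatrix_comp B b B i f
    rw [hf] at hcomp
    have hdet := congrArg Matrix.det hcomp
    rw [map_smul, LinearMap.toMatrix_id, Matrix.det_smul, Matrix.det_mul, Matrix.det_one,
      mul_one] at hdet
    exact hn ((Nat.prime_iff_prime_int.mp hℓ).dvd_of_dvd_pow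
      (hdet ▸ hdvd.mul_right _ : (ℓ : ℤ) ∣ n ^ _))

/-- The discriminant of the ring of integers is the greatest common divisor of the discriminants
of a family of sublattices among which there is a maximal one at every prime. -/
theorem associated_gcd_sq_mul {ι : Type*} (s : Finset ι) (k : ι → ℤ) (D : ℤ)
    (h : ∀ ℓ : ℕ, ℓ.Prime → ∃ j ∈ s, ¬ (ℓ : ℤ) ∣ k j) :
    Associated D (s.gcd fun j => k j ^ 2 * D) := by
  rw [Finset.gcd_mul_right]
  have h1 : s.gcd (fun j => k j ^ 2) = 1 := by
    rw [← Finset.normalize_gcd, normalize_eq_one, Int.isUnit_iff_natAbs_eq]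
    by_contra hne
    obtain ⟨ℓ, hℓ, hdvd⟩ := Nat.exists_prime_and_dvd hne
    obtain ⟨j, hj, hjk⟩ := h ℓ hℓ
    exact hjk ((Nat.prime_iff_prime_int.mp hℓ).dvd_of_dvd_pow
      ((Int.natCast_dvd.mpr hdvd).trans (Finset.gcd_dvd hj)))
  rw [h1, one_mul]
  exact (normalize_associated D).symm

end

/-! ### Radical elements: Eisenstein polynomials, discriminants and traces -/

section

open Polynomial

theorem isEisensteinAt_X_pow_sub_C {n : ℕ} (hn : 1 < n) {c g : ℤ} {q : ℕ} (hq : q.Prime)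
    (hc : c = q * g) (hg : ¬ (q : ℤ) ∣ g) :
    (X ^ n - C c : ℤ[X]).IsEisensteinAt (Submodule.span ℤ {(q : ℤ)}) := by
  have hmon : (X ^ n - C c : ℤ[X]).Monic := monic_X_pow_sub_C c (by lia)
  have hq0 : (q : ℤ) ≠ 0 := by exact_mod_cast hq.ne_zero
  refine hmon.isEisensteinAt_of_mem_of_notMem ?_ ?_ ?_
  · rw [Ideal.submodule_span_eq, Ne, Ideal.span_singleton_eq_top]
    exact (Nat.prime_iff_prime_int.mp hq).not_isUnit
  · intro k hk
    rw [natDegree_X_pow_sub_C] at hk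
    rw [Ideal.submodule_span_eq, Ideal.mem_span_singleton, coeff_sub, coeff_X_pow, coeff_C,
      if_neg hk.ne]
    split_ifs
    · simp [hc]
    · simp
  · rw [Ideal.submodule_span_eq, Ideal.span_singleton_pow, Ideal.mem_span_singleton, coeff_sub,
      coeff_X_pow, if_neg (by lia), coeff_C_zero, zero_sub, dvd_neg, hc, pow_two,
      mul_dvd_mul_iff_left hq0]
    exact hg

theorem irreducible_X_pow_sub_C_of_eisenstein {n : ℕ} (hn : 1 < n) {c g : ℤ} {q : ℕ}
    (hq : q.Prime) (hc : c = q * g) (hg : ¬ (q : ℤ) ∣ g) : Irreducible (X ^ n - C c : ℤ[X]) := by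
  have hmon : (X ^ n - C c : ℤ[X]).Monic := monic_X_pow_sub_C c (by lia)
  refine (isEisensteinAt_X_pow_sub_C hn hq hc hg).irreducible ?_ hmon.isPrimitive ?_
  · rw [Ideal.submodule_span_eq, Ideal.span_singleton_prime (by exact_mod_cast hq.ne_zero)]
    exact Nat.prime_iff_prime_int.mp hq
  · rw [natDegree_X_pow_sub_C]
    lia

variable {K : Type*} [Field K] {p : ℕ} {c : ℤ} {γ π β : K}

theorem isIntegral_of_pow_eq (hp : p.Prime) (hγ : γ ^ p = c) : IsIntegral ℤ γ :=
  ⟨X ^ p - C c, monic_X_pow_sub_C c hp.ne_zero, by rw [← aeval_def]; simp [hγ]⟩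

variable [NumberField K]

theorem minpoly_rat_of_eisenstein (hp : p.Prime) (hγ : γ ^ p = c) {g : ℤ} {q : ℕ} (hq : q.Prime)
    (hc : c = q * g) (hg : ¬ (q : ℤ) ∣ g) : minpoly ℚ γ = X ^ p - C (c : ℚ) := by
  have hmon : (X ^ p - C c : ℤ[X]).Monic := monic_X_pow_sub_C c hp.ne_zero
  have h := hmon.irreducible_iff_irreducible_map_fraction_map (K := ℚ).mp
    (irreducible_X_pow_sub_C_of_eisenstein hp.one_lt hq hc hg)
  rw [← minpoly.eq_of_irreducible_of_monic h (by simp [hγ]) (hmon.map _)]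
  simp

theorem minpoly_int_of_eisenstein (hp : p.Prime) (hγ : γ ^ p = c) {g : ℤ} {q : ℕ} (hq : q.Prime)
    (hc : c = q * g) (hg : ¬ (q : ℤ) ∣ g) : minpoly ℤ γ = X ^ p - C c := by
  have h := minpoly.isIntegrallyClosed_eq_field_fractions' ℚ (isIntegral_of_pow_eq hp hγ)
  rw [minpoly_rat_of_eisenstein hp hγ hq hc hg] at h
  refine (Polynomial.map_injective (algebraMap ℤ ℚ) Int.cast_injective ?_).symm
  rw [← h]
  simp

theorem exists_powerBasis_gen_eq {x : K} (h : (minpoly ℚ x).natDegree = Module.finrank ℚ K) :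
    ∃ pb : PowerBasis ℚ K, pb.gen = x := by
  have h1 := (Field.primitive_element_iff_minpoly_natDegree_eq ℚ x).mpr h
  have hx : IsIntegral ℚ x := Algebra.IsIntegral.isIntegral x
  have h2 : Algebra.adjoin ℚ {x} = ⊤ := by
    rw [← IntermediateField.adjoin_simple_toSubalgebra_of_isAlgebraic hx.isAlgebraic, h1]
    rfl
  exact ⟨PowerBasis.ofAdjoinEqTop hx h2, PowerBasis.ofAdjoinEqTop_gen hx h2⟩

theorem norm_of_pow_eq (hp2 : Odd p) (hfin : Module.finrank ℚ K = p) (hγ : γ ^ p = c) :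
    Algebra.norm ℚ γ = c := by
  refine hp2.pow_injective (?_ : Algebra.norm ℚ γ ^ p = (c : ℚ) ^ p)
  rw [← map_pow, hγ]
  have := Algebra.norm_algebraMap_of_basis (Module.finBasis ℚ K) (c : ℚ)
  simpa [hfin] using this

/-- The discriminant of the powers of a translate of a `p`-th root. -/
theorem discr_powerBasis_of_radical (hp2 : Odd p)
    (hfin : Module.finrank ℚ K = p) (hγ : γ ^ p = c) (hmin : minpoly ℚ γ = X ^ p - C (c : ℚ))
    (n : ℤ) (pb : PowerBasis ℚ K) (hpb : pb.gen = γ - n) :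
    Algebra.discr ℚ pb.basis = (-1) ^ ((p - 1) / 2) * (p : ℚ) ^ p * (c : ℚ) ^ (p - 1) := by
  have h1 : minpoly ℚ pb.gen = (X ^ p - C (c : ℚ)).comp (X + C (n : ℚ)) := by
    rw [hpb, ← hmin, ← minpoly.sub_algebraMap]
    simp
  have h2 : aeval pb.gen (derivative (minpoly ℚ pb.gen)) = algebraMap ℚ K p * γ ^ (p - 1) := by
    rw [h1, hpb]
    rw [sub_comp, X_pow_comp, C_comp, derivative_sub, derivative_C, sub_zero, derivative_X_add_C_pow]
    simp
  rw [Algebra.discr_powerBasis_eq_norm, h2, map_mul, map_pow, norm_of_pow_eq hp2 hfin hγ, hfin,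
    Algebra.norm_algebraMap, hfin, ← mul_assoc]
  congr 2
  obtain ⟨k, hk⟩ := hp2
  have : p * (p - 1) / 2 = p * k := by
    rw [hk, Nat.add_sub_cancel, show (2 * k + 1) * (2 * k) = 2 * ((2 * k + 1) * k) by ring]
    simp
  rw [this, pow_mul, Odd.neg_one_pow ⟨k, hk⟩]
  congr 1
  lia

/-- Multiplication by `γ ^ k` shifts the basis `1, …, γ ^ (p - 1)` cyclically, up to factors `c`, so
its matrix has zero diagonal. -/
theorem trace_pow_of_radical (hfin : Module.finrank ℚ K = p) (hγ : γ ^ p = c)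
    (hmin : minpoly ℚ γ = X ^ p - C (c : ℚ)) {k : ℕ} (hk : 0 < k) (hkp : k < p) :
    Algebra.trace ℚ K (γ ^ k) = 0 := by
  obtain ⟨pb, hpb⟩ := exists_powerBasis_gen_eq (x := γ) (by
    rw [hmin, natDegree_X_pow_sub_C, hfin])
  have hdim : pb.dim = p := by rw [← pb.finrank, hfin]
  rw [Algebra.trace_eq_matrix_trace pb.basis, Matrix.trace]
  refine Finset.sum_eq_zero fun i _ => ?_
  rw [Matrix.diag_apply, Algebra.leftMulMatrix_apply, LinearMap.toMatrix_apply,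
    Algebra.coe_lmul_eq_mul, LinearMap.mul_apply', pb.basis_eq_pow, hpb, ← pow_add]
  have hi := i.2
  by_cases h : k + i < p
  · have : γ ^ (k + (i : ℕ)) = pb.basis ⟨k + i, by lia⟩ := by rw [pb.basis_eq_pow, hpb]
    rw [this, Module.Basis.repr_self, Finsupp.single_apply, if_neg]
    intro h'
    have := congrArg Fin.val h'
    simp only at this
    lia
  · have : γ ^ (k + (i : ℕ)) = (c : ℚ) • pb.basis ⟨k + i - p, by lia⟩ := by
      rw [pb.basis_eq_pow, hpb, Algebra.smul_def, map_intCast, ← hγ, ← pow_add]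
      congr 1
      simp only
      lia
    rw [this, map_smul, Module.Basis.repr_self, Finsupp.smul_apply, Finsupp.single_apply, if_neg,
      smul_zero]
    intro h'
    have := congrArg Fin.val h'
    simp only at this
    lia

theorem trace_adjoin_of_radical (hp : p.Prime) (hfin : Module.finrank ℚ K = p) (hγ : γ ^ p = c)
    (hmin : minpoly ℚ γ = X ^ p - C (c : ℚ)) {g : K} (hg : g ∈ Algebra.adjoin ℤ {γ}) :
    ∃ m : ℤ, Algebra.trace ℚ K g = p * m := by
  rw [Algebra.adjoin_singleton_eq_range_aeval] at hg
  obtain ⟨f, rfl⟩ := hg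
  have hint : ∀ n : ℤ, Algebra.trace ℚ K (n : K) = p * n := by
    intro n
    have := Algebra.trace_algebraMap (S := K) (n : ℚ)
    rw [map_intCast, hfin] at this
    simpa using this
  have hsmul : ∀ (n : ℤ) (x : K), Algebra.trace ℚ K (n * x) = n * Algebra.trace ℚ K x := by
    intro n x
    rw [← zsmul_eq_mul, map_zsmul, zsmul_eq_mul]
  have hpow : ∀ k : ℕ, ∃ m : ℤ, Algebra.trace ℚ K (γ ^ k) = p * m := by
    intro k
    have hk : γ ^ k = ((c ^ (k / p) : ℤ) : K) * γ ^ (k % p) := by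
      conv_lhs => rw [← Nat.div_add_mod k p, pow_add, pow_mul, hγ]
      push_cast
      rfl
    rw [hk, hsmul]
    rcases Nat.eq_zero_or_pos (k % p) with h0 | h0
    · refine ⟨c ^ (k / p), ?_⟩
      have := hint 1
      rw [Int.cast_one] at this
      rw [h0, pow_zero, this]
      push_cast
      ring
    · exact ⟨0, by rw [trace_pow_of_radical hfin hγ hmin h0 (Nat.mod_lt _ hp.pos)]; simp⟩
  change ∃ m : ℤ, Algebra.trace ℚ K (aeval γ f) = p * m
  induction f using Polynomial.induction_on' with
  | add f g hf hg =>
    obtain ⟨m, hm⟩ := hf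
    obtain ⟨n, hn⟩ := hg
    exact ⟨m + n, by rw [map_add, map_add, hm, hn]; push_cast; ring⟩
  | monomial k n =>
    obtain ⟨m, hm⟩ := hpow k
    refine ⟨n * m, ?_⟩
    rw [aeval_monomial, eq_intCast, hsmul, hm]
    push_cast
    ring

/-- In the binomial expansion of `p β = (γ - c) ^ (p - 1)` only the constant term has nonzero trace.
-/
theorem trace_beta_of_radical (hp : p.Prime) (hp2 : Odd p) (hfin : Module.finrank ℚ K = p)
    (hγ : γ ^ p = c) (hmin : minpoly ℚ γ = X ^ p - C (c : ℚ)) (hπ : π = γ - c)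
    (hβ : p * β = π ^ (p - 1)) : Algebra.trace ℚ K β = (c : ℚ) ^ (p - 1) := by
  have hp0 : (p : ℚ) ≠ 0 := by exact_mod_cast hp.ne_zero
  refine mul_left_cancel₀ hp0 ?_
  have hsmul : ∀ (n : ℚ) (x : K), Algebra.trace ℚ K (algebraMap ℚ K n * x) =
      n * Algebra.trace ℚ K x := by
    intro n x
    rw [← Algebra.smul_def, map_smul, smul_eq_mul]
  have h1 := hsmul p β
  rw [map_natCast, hβ] at h1
  rw [← h1, hπ, sub_eq_add_neg, add_pow, map_sum, Finset.sum_eq_single_of_mem 0 (by simp)]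
  · have h2 := Algebra.trace_algebraMap (S := K) ((c : ℚ) ^ (p - 1))
    rw [hfin, map_pow, map_intCast] at h2
    have he : Even (p - 1) := hp2.tsub_odd odd_one
    simp [he.neg_pow, h2]
  · intro k hk hk0
    have h2 := hsmul ((-c) ^ (p - 1 - k) * ((p - 1).choose k)) (γ ^ k)
    rw [trace_pow_of_radical hfin hγ hmin (Nat.pos_of_ne_zero hk0)
      (by have := Finset.mem_range.mp hk; have := hp.pos; lia), mul_zero] at h2
    rw [← h2]
    congr 1
    push_cast
    simp
    ring

/-- The discriminant `± p ^ p (q g) ^ (p - 1)` multiplies integral elements into `ℤ[γ]`; the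
Eisenstein property at `q` allows the factor `q ^ (p - 1)` to be dropped. -/
theorem smul_mem_adjoin_of_eisenstein (hp : p.Prime) (hp2 : Odd p)
    (hfin : Module.finrank ℚ K = p) (hγ : γ ^ p = c) {g : ℤ} {q : ℕ} (hq : q.Prime)
    (hc : c = q * g) (hg : ¬ (q : ℤ) ∣ g) {z : K} (hz : IsIntegral ℤ z) :
    ((p : ℤ) ^ p * g ^ (p - 1)) • z ∈ Algebra.adjoin ℤ {γ} := by
  have hmin := minpoly_rat_of_eisenstein hp hγ hq hc hg
  obtain ⟨pb, hpb⟩ := exists_powerBasis_gen_eq (x := γ) (by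
    rw [hmin, natDegree_X_pow_sub_C, hfin])
  have hint : IsIntegral ℤ pb.gen := hpb ▸ isIntegral_of_pow_eq hp hγ
  have hd := Algebra.discr_mul_isIntegral_mem_adjoin ℚ hint hz
  have hz' : IsIntegral ℤ (((p : ℤ) ^ p * g ^ (p - 1)) • z) := hz.smul _
  rw [← hpb]
  refine mem_adjoin_of_smul_prime_pow_smul_of_minpoly_isEisensteinAt (K := ℚ) (n := p - 1)
    (Nat.prime_iff_prime_int.mp hq) hint hz' ?_ ?_
  · rw [discr_powerBasis_of_radical hp2 hfin hγ hmin 0 pb (by simp [hpb])] at hd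
    have h2 : (q : ℤ) ^ (p - 1) • ((p : ℤ) ^ p * g ^ (p - 1)) • z = ((-1) ^ ((p - 1) / 2) : ℤ) •
        (((-1) ^ ((p - 1) / 2) * (p : ℚ) ^ p * (c : ℚ) ^ (p - 1)) • z) := by
      rw [Algebra.smul_def ((-1) ^ ((p - 1) / 2) * (p : ℚ) ^ p * (c : ℚ) ^ (p - 1)), hc]
      have h3 : ((-1) ^ ((p - 1) / 2) * (-1) ^ ((p - 1) / 2) : K) = 1 := by
        rw [← mul_pow]
        simp
      simp only [zsmul_eq_mul]
      push_cast
      simp only [map_intCast]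
      rw [mul_pow]
      linear_combination (-(q : K) ^ (p - 1) * p ^ p * g ^ (p - 1) * z) * h3
    rw [h2]
    exact Subalgebra.zsmul_mem _ hd _
  · rw [hpb, minpoly_int_of_eisenstein hp hγ hq hc hg]
    exact isEisensteinAt_X_pow_sub_C hp.one_lt hq hc hg

end

/-! ### The ring `ℤ[β, γ]`: relations, integrality, a basis and its discriminant -/

section

open Polynomial

variable {K : Type*} [Field K] {p : ℕ} {c t : ℤ} {γ π β : K}

theorem translate_mem_adjoin (hπ : π = γ - c) : π ∈ Algebra.adjoin ℤ {γ} :=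
  hπ ▸ sub_mem (Algebra.self_mem_adjoin_singleton ℤ γ) (intCast_mem _ c)

theorem exists_eq_intCast_add_mul (hπ : π = γ - c) {g : K} (hg : g ∈ Algebra.adjoin ℤ {γ}) :
    ∃ n : ℤ, ∃ g' ∈ Algebra.adjoin ℤ {γ}, g = n + π * g' := by
  have hπG := translate_mem_adjoin hπ
  induction hg using Algebra.adjoin_induction with
  | mem x hx =>
    rw [Set.mem_singleton_iff] at hx
    exact ⟨c, 1, one_mem _, by rw [hx, hπ]; ring⟩
  | algebraMap r => exact ⟨r, 0, zero_mem _, by simp⟩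
  | add x y _ _ hx hy =>
    obtain ⟨n, g, hg, rfl⟩ := hx
    obtain ⟨m, g', hg', rfl⟩ := hy
    exact ⟨n + m, g + g', add_mem hg hg', by push_cast; ring⟩
  | mul x y _ _ hx hy =>
    obtain ⟨n, g, hg, rfl⟩ := hx
    obtain ⟨m, g', hg', rfl⟩ := hy
    exact ⟨n * m, n * g' + m * g + π * g * g', add_mem (add_mem (mul_mem (intCast_mem _ n) hg')
      (mul_mem (intCast_mem _ m) hg)) (mul_mem (mul_mem hπG hg) hg'), by push_cast; ring⟩

variable [NumberField K]

/-- Expanding `(π + c) ^ p = c` gives `π ^ p + p π w + (c ^ p - c) = 0`; dividing by `p` yields `β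
π`, and multiplying that by `π ^ (p - 2)` yields `β ^ 2`. The first two coefficients of `w` are kept
explicit: the constant one is `≡ 1` mod `p ^ 2`, and the linear one is needed for `p ≥ 5`. -/
theorem exists_mul_relations (hp : p.Prime) (hp2 : Odd p) (hγ : γ ^ p = c) (hπ : π = γ - c)
    (hβ : p * β = π ^ (p - 1)) (ht : c ^ (p - 1) - 1 = p ^ 2 * t) :
    ∃ h ∈ Algebra.adjoin ℤ {γ}, ∃ w : K,
      w = c ^ (p - 1) + (((p - 1) / 2 : ℕ) * c ^ (p - 2) : ℤ) * π + π ^ 2 * h ∧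
      β * π = -π * w - p * c * t ∧ β ^ 2 = -w * β - c * t * π ^ (p - 2) := by
  have hp3 : 3 ≤ p := by obtain ⟨k, hk⟩ := hp2; have := hp.one_lt; lia
  have hp0 : (p : K) ≠ 0 := by exact_mod_cast hp.ne_zero
  have hπG := translate_mem_adjoin hπ
  set S : K := ∑ k ∈ Finset.Ioo 2 p, π ^ (k - 3) * c ^ (p - k - 1) * ((p.choose k / p : ℕ) : K)
    with hS
  have hSG : (c : K) * S ∈ Algebra.adjoin ℤ {γ} :=
    mul_mem (intCast_mem _ c) (sum_mem fun k _ => mul_mem (mul_mem (pow_mem hπG _)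
      (pow_mem (intCast_mem _ c) _)) (natCast_mem _ _))
  refine ⟨c * S, hSG, _, rfl, ?_⟩
  set w : K := c ^ (p - 1) + (((p - 1) / 2 : ℕ) * c ^ (p - 2) : ℤ) * π + π ^ 2 * (c * S) with hw
  have hsum : (c : K) * ∑ k ∈ Finset.Ioo 0 p,
      π ^ (k - 1) * c ^ (p - k - 1) * ((p.choose k / p : ℕ) : K) = w := by
    have hI : Finset.Ioo 0 p = insert 1 (insert 2 (Finset.Ioo 2 p)) := by
      ext k
      simp only [Finset.mem_Ioo, Finset.mem_insert]
      lia
    have h2 : p.choose 2 / p = (p - 1) / 2 := by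
      obtain ⟨k, hk⟩ := hp2
      rw [Nat.choose_two_right, hk, Nat.add_sub_cancel,
        show (2 * k + 1) * (2 * k) = 2 * ((2 * k + 1) * k) by ring,
        Nat.mul_div_cancel_left _ two_pos, Nat.mul_div_cancel_left _ (by lia),
        Nat.mul_div_cancel_left _ two_pos]
    have h3 : ∑ k ∈ Finset.Ioo 2 p, π ^ (k - 1) * (c : K) ^ (p - k - 1) *
        ((p.choose k / p : ℕ) : K) = π ^ 2 * S := by
      rw [hS, Finset.mul_sum]
      refine Finset.sum_congr rfl fun k hk => ?_
      rw [Finset.mem_Ioo] at hk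
      rw [show k - 1 = 2 + (k - 3) by lia, pow_add]
      ring
    rw [hI, Finset.sum_insert (by simp), Finset.sum_insert (by simp), h2, h3, hw,
      Nat.choose_one_right, Nat.div_self hp.pos, show p - 1 = (p - 3) + 2 by lia,
      show p - 2 = (p - 3) + 1 by lia, show p - 3 + 2 - 1 = (p - 3) + 1 by lia,
      Nat.add_sub_cancel]
    generalize (p - 3 + 2) / 2 = m
    push_cast
    ring
  have hpow := add_pow_prime_eq hp π (c : K)
  have hπc : π + c = γ := by rw [hπ]; ring
  rw [hπc, hγ] at hpow
  have ht' : (c : K) ^ p - c = p ^ 2 * (c * t) := by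
    have : (c : K) ^ (p - 1) - 1 = p ^ 2 * t := by exact_mod_cast congrArg (Int.cast : ℤ → K) ht
    rw [show (c : K) ^ p = c * c ^ (p - 1) by rw [← pow_succ']; congr 1; lia]
    linear_combination (c : K) * this
  have hπp : π ^ p = p * β * π := by rw [hβ, ← pow_succ]; congr 1; lia
  have h1 : β * π = -π * w - p * c * t := by
    refine mul_left_cancel₀ hp0 ?_
    linear_combination -hπp - hpow + (-(p : K) * π) * hsum - ht'
  refine ⟨h1, mul_left_cancel₀ hp0 ?_⟩
  have h2 : (p : K) * β = π ^ (p - 2) * π := by rw [hβ, ← pow_succ]; congr 1; lia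
  linear_combination (β + w) * h2 + π ^ (p - 2) * h1

theorem isIntegral_beta (hp : p.Prime) (hp2 : Odd p) (hγ : γ ^ p = c) (hπ : π = γ - c)
    (hβ : p * β = π ^ (p - 1)) (ht : c ^ (p - 1) - 1 = p ^ 2 * t) : IsIntegral ℤ β := by
  obtain ⟨h, hh, w, hw, -, hβ2⟩ := exists_mul_relations hp hp2 hγ hπ hβ ht
  have hπG := translate_mem_adjoin hπ
  have hG := adjoin_le_integralClosure (isIntegral_of_pow_eq hp hγ)
  have hwO : w ∈ integralClosure ℤ K := hG (hw ▸ add_mem (add_mem (pow_mem (intCast_mem _ c) _)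
    (mul_mem (intCast_mem _ _) hπG)) (mul_mem (pow_mem hπG _) hh))
  have hvO : (c : K) * t * π ^ (p - 2) ∈ integralClosure ℤ K :=
    hG (mul_mem (mul_mem (intCast_mem _ c) (intCast_mem _ t)) (pow_mem hπG _))
  refine isIntegral_trans (A := integralClosure ℤ K) β
    ⟨X ^ 2 + (C ⟨w, hwO⟩ * X + C ⟨_, hvO⟩), ?_, ?_⟩
  · refine monic_X_pow_add ?_
    exact lt_of_le_of_lt degree_linear_le (by norm_num)
  · rw [← aeval_def]
    simp only [map_add, map_mul, aeval_X, aeval_C, map_pow]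
    change β ^ 2 + (w * β + c * t * π ^ (p - 2)) = 0
    rw [hβ2]
    ring

/-- `β π` lies in `ℤ[γ]`, and `ℤ[γ] = ℤ + π ℤ[γ]`. -/
theorem beta_mul_mem (hp : p.Prime) (hp2 : Odd p) (hγ : γ ^ p = c) (hπ : π = γ - c)
    (hβ : p * β = π ^ (p - 1)) (ht : c ^ (p - 1) - 1 = p ^ 2 * t) {g : K}
    (hg : g ∈ Algebra.adjoin ℤ {γ}) :
    ∃ g' ∈ Algebra.adjoin ℤ {γ}, ∃ n : ℤ, β * g = g' + n * β := by
  obtain ⟨h, hh, w, hw, hβπ, -⟩ := exists_mul_relations hp hp2 hγ hπ hβ ht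
  have hπG := translate_mem_adjoin hπ
  have hwG : w ∈ Algebra.adjoin ℤ {γ} := hw ▸ add_mem (add_mem (pow_mem (intCast_mem _ c) _)
    (mul_mem (intCast_mem _ _) hπG)) (mul_mem (pow_mem hπG _) hh)
  obtain ⟨n, g', hg', rfl⟩ := exists_eq_intCast_add_mul hπ hg
  refine ⟨(-π * w - p * c * t) * g', mul_mem (sub_mem (mul_mem (neg_mem hπG) hwG)
    (mul_mem (mul_mem (natCast_mem _ _) (intCast_mem _ _)) (intCast_mem _ _))) hg', n, ?_⟩
  rw [← hβπ]
  ring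

/-- The ring `ℤ[β, γ]` is `ℤ[γ] + ℤ β`. -/
theorem mem_adjoin_sup_adjoin_iff (hp : p.Prime) (hp2 : Odd p) (hγ : γ ^ p = c) (hπ : π = γ - c)
    (hβ : p * β = π ^ (p - 1)) (ht : c ^ (p - 1) - 1 = p ^ 2 * t) {x : K} :
    x ∈ Algebra.adjoin ℤ {β} ⊔ Algebra.adjoin ℤ {γ} ↔
      ∃ g ∈ Algebra.adjoin ℤ {γ}, ∃ n : ℤ, x = g + n * β := by
  have hβG : β ∈ Algebra.adjoin ℤ {β} ⊔ Algebra.adjoin ℤ {γ} :=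
    le_sup_left (a := Algebra.adjoin ℤ {β}) (Algebra.self_mem_adjoin_singleton ℤ β)
  constructor
  · intro hx
    rw [← Algebra.adjoin_union] at hx
    obtain ⟨h, hh, w, hw, hβπ, hβ2⟩ := exists_mul_relations hp hp2 hγ hπ hβ ht
    have hπG := translate_mem_adjoin hπ
    have hwG : w ∈ Algebra.adjoin ℤ {γ} := hw ▸ add_mem (add_mem (pow_mem (intCast_mem _ c) _)
      (mul_mem (intCast_mem _ _) hπG)) (mul_mem (pow_mem hπG _) hh)
    induction hx using Algebra.adjoin_induction with
    | mem x hx =>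
      rcases hx with hx | hx
      · exact ⟨0, zero_mem _, 1, by rw [Set.mem_singleton_iff.mp hx]; simp⟩
      · exact ⟨x, Algebra.subset_adjoin hx, 0, by simp⟩
    | algebraMap r => exact ⟨r, intCast_mem _ r, 0, by simp⟩
    | add x y _ _ hx hy =>
      obtain ⟨g, hg, n, rfl⟩ := hx
      obtain ⟨g', hg', n', rfl⟩ := hy
      exact ⟨g + g', add_mem hg hg', n + n', by push_cast; ring⟩
    | mul x y _ _ hx hy =>
      obtain ⟨g, hg, n, rfl⟩ := hx
      obtain ⟨g', hg', n', rfl⟩ := hy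
      obtain ⟨e, he, m, hm⟩ := beta_mul_mem hp hp2 hγ hπ hβ ht
        (add_mem (add_mem (mul_mem (intCast_mem _ n) hg') (mul_mem (intCast_mem _ n') hg))
          (mul_mem (mul_mem (intCast_mem _ n) (intCast_mem _ n')) (neg_mem hwG)))
      refine ⟨g * g' + e - n * n' * (c * t * π ^ (p - 2)), sub_mem (add_mem (mul_mem hg hg') he)
        (mul_mem (mul_mem (intCast_mem _ n) (intCast_mem _ n'))
          (mul_mem (mul_mem (intCast_mem _ c) (intCast_mem _ t)) (pow_mem hπG _))), m, ?_⟩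
      linear_combination hm + n * n' * hβ2
  · rintro ⟨g, hg, n, rfl⟩
    exact add_mem (le_sup_right (a := Algebra.adjoin ℤ {β}) hg) (mul_mem (intCast_mem _ n) hβG)

/-- `ℤ[β, γ]` is generated as a group by `1, π, …, π ^ (p - 2), β`. -/
theorem span_eq_adjoin_sup_adjoin (hp : p.Prime) (hp2 : Odd p) (hγ : γ ^ p = c)
    (hπ : π = γ - c) (hβ : p * β = π ^ (p - 1)) (ht : c ^ (p - 1) - 1 = p ^ 2 * t)
    {n : ℕ} (hn : n = p) :
    Submodule.span ℤ (Set.range fun k : Fin n => if (k : ℕ) + 1 = p then β else π ^ (k : ℕ)) =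
      Subalgebra.toSubmodule (Algebra.adjoin ℤ {β} ⊔ Algebra.adjoin ℤ {γ}) := by
  subst hn
  have hβG : β ∈ Algebra.adjoin ℤ {β} ⊔ Algebra.adjoin ℤ {γ} :=
    le_sup_left (a := Algebra.adjoin ℤ {β}) (Algebra.self_mem_adjoin_singleton ℤ β)
  have hπG := translate_mem_adjoin hπ
  refine le_antisymm ?_ ?_
  · rw [Submodule.span_le]
    rintro _ ⟨k, rfl⟩
    simp only
    split_ifs
    · exact hβG
    · exact le_sup_right (a := Algebra.adjoin ℤ {β}) (pow_mem hπG _)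
  · intro x hx
    rw [Subalgebra.mem_toSubmodule, mem_adjoin_sup_adjoin_iff hp hp2 hγ hπ hβ ht] at hx
    obtain ⟨g, hg, m, rfl⟩ := hx
    set M := Submodule.span ℤ
      (Set.range fun k : Fin n => if (k : ℕ) + 1 = n then β else π ^ (k : ℕ))
    have hβM : β ∈ M := Submodule.subset_span
      ⟨⟨n - 1, Nat.sub_lt hp.pos one_pos⟩, by simp [Nat.sub_add_cancel hp.one_le]⟩
    refine add_mem ?_ (by rw [← zsmul_eq_mul]; exact M.smul_mem m hβM)
    have hpowM : ∀ k < n, π ^ k ∈ M := by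
      intro k hk
      by_cases h : k + 1 = n
      · rw [show k = n - 1 by lia, ← hβ, ← nsmul_eq_mul]
        exact M.smul_of_tower_mem n hβM
      · exact Submodule.subset_span ⟨⟨k, hk⟩, by simp [h]⟩
    have hg' : g ∈ Algebra.adjoin ℤ {π} := by
      refine (Algebra.adjoin_le ?_ : Algebra.adjoin ℤ {γ} ≤ _) hg
      rw [Set.singleton_subset_iff, show γ = π + c by rw [hπ]; ring]
      exact add_mem (Algebra.self_mem_adjoin_singleton ℤ π) (intCast_mem _ c)
    rw [Algebra.adjoin_singleton_eq_range_aeval] at hg'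
    obtain ⟨f, rfl⟩ := hg'
    -- A monic polynomial of degree `p` vanishing at `π`: division by it leaves only powers below
    -- `p`, and the top one `π ^ (p - 1)` is `p β`.
    let P : ℤ[X] := (X + C c) ^ n - C c
    have hdeg : (C c : ℤ[X]).degree < ((X + C c) ^ n : ℤ[X]).degree := by
      refine lt_of_le_of_lt degree_C_le ?_
      rw [degree_pow, degree_X_add_C]
      simpa using hp.pos
    have hP : P.Monic := ((monic_X_add_C c).pow n).sub_of_left hdeg
    have hPdeg : P.degree = n := by
      rw [degree_sub_eq_left_of_degree_lt hdeg, degree_pow, degree_X_add_C]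
      simp
    have hP0 : aeval π P = 0 := by simp [P, hπ, hγ]
    have hf : aeval π f = aeval π (f %ₘ P) := by
      conv_lhs => rw [← modByMonic_add_div f P]
      simp [hP0]
    change aeval π f ∈ M
    rw [hf, aeval_eq_sum_range' (n := n)]
    · exact Submodule.sum_mem _ fun k hk => M.smul_mem _ (hpowM k (Finset.mem_range.mp hk))
    · have hPn : P.natDegree = n := natDegree_eq_of_degree_eq_some hPdeg
      have := natDegree_modByMonic_lt f hP (fun h => hp.ne_zero (by rw [← hPn, h, natDegree_one]))
      rwa [hPn] at this

theorem hasDiscr_adjoin_sup_adjoin (hp : p.Prime) (hp2 : Odd p) (hfin : Module.finrank ℚ K = p)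
    (hγ : γ ^ p = c) (hmin : minpoly ℚ γ = X ^ p - C (c : ℚ)) (hπ : π = γ - c)
    (hβ : p * β = π ^ (p - 1)) (ht : c ^ (p - 1) - 1 = p ^ 2 * t) (hc : c ≠ 0) :
    HasDiscr (Subalgebra.toSubmodule (Algebra.adjoin ℤ {β} ⊔ Algebra.adjoin ℤ {γ}))
      ((-1) ^ ((p - 1) / 2) * (p : ℤ) ^ (p - 2) * c ^ (p - 1)) := by
  have hp0 : (p : ℚ) ≠ 0 := by exact_mod_cast hp.ne_zero
  obtain ⟨pb, hpb⟩ := exists_powerBasis_gen_eq (x := π) (by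
    have h := minpoly.sub_algebraMap γ (c : ℚ)
    rw [map_intCast, ← hπ, hmin] at h
    rw [h, natDegree_comp, natDegree_X_pow_sub_C, natDegree_X_add_C, hfin, mul_one])
  have hdim : pb.dim = p := by rw [← pb.finrank, hfin]
  let b : Fin pb.dim → K := fun k => if (k : ℕ) + 1 = p then β else π ^ (k : ℕ)
  have hD := discr_powerBasis_of_radical hp2 hfin hγ hmin c pb (hpb.trans hπ)
  -- The power basis of `π` differs from `b` only in its last entry `π ^ (p - 1) = p β`, which costs
  -- a factor `p ^ 2` in the discriminant.
  have hmat : ⇑pb.basis = Matrix.vecMul b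
      ((Matrix.diagonal fun k : Fin pb.dim => if (k : ℕ) + 1 = p then (p : ℚ) else 1).map
        (algebraMap ℚ K)) := by
    funext k
    rw [pb.basis_eq_pow, hpb, Matrix.diagonal_map (map_zero _), Matrix.vecMul_diagonal]
    simp only [b]
    split_ifs with h
    · rw [map_natCast, mul_comm, hβ, ← h, Nat.add_sub_cancel]
    · rw [map_one, mul_one]
  have hprod : ∏ k : Fin pb.dim, (if (k : ℕ) + 1 = p then (p : ℚ) else 1) = p := by
    rw [Finset.prod_eq_single (⟨p - 1, by rw [hdim]; exact Nat.sub_lt hp.pos one_pos⟩ :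
      Fin pb.dim)]
    · simp [Nat.sub_add_cancel hp.one_le]
    · intro k _ hk
      rw [if_neg]
      intro h
      exact hk (Fin.ext (by simp only; lia))
    · simp
  refine hasDiscr_of_span (b := b) (by rw [Fintype.card_fin, hdim, hfin]) ?_ ?_
    (span_eq_adjoin_sup_adjoin hp hp2 hγ hπ hβ ht hdim)
  · rw [hmat, Algebra.discr_of_matrix_vecMul, Matrix.det_diagonal, hprod] at hD
    refine mul_left_cancel₀ (pow_ne_zero 2 hp0) ?_
    rw [hD]
    have : (p : ℚ) ^ p = p ^ 2 * p ^ (p - 2) := by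
      rw [← pow_add]; congr 1; have := hp.two_le; lia
    rw [this]
    push_cast
    ring
  · have : (p : ℤ) ≠ 0 := by exact_mod_cast hp.ne_zero
    positivity

end

/-! ### Maximality of `ℤ[β, γ]` at `p` -/

section

open Polynomial

variable {K : Type*} [Field K] [NumberField K] {p : ℕ} {c t : ℤ} {γ π β : K}

theorem exists_trace_eq_of_isIntegral {z : K} (hz : IsIntegral ℤ z) :
    ∃ m : ℤ, Algebra.trace ℚ K z = m := by
  obtain ⟨m, hm⟩ := IsIntegrallyClosed.isIntegral_iff.mp (Algebra.isIntegral_trace (L := ℚ) hz)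
  exact ⟨m, by rw [← hm]; simp⟩

theorem trace_intCast_mul (n : ℤ) (x : K) :
    Algebra.trace ℚ K (n * x) = n * Algebra.trace ℚ K x := by
  rw [← zsmul_eq_mul, map_zsmul, zsmul_eq_mul]

/-- The relations give `β ^ 2 ≡ -β` modulo `π ℤ[γ] + p 𝓞`. Both error terms have trace in `pℤ`, so
the traces of powers of `β` are known mod `p`. -/
theorem exists_pow_beta_eq (hp : p.Prime) (hp2 : Odd p) (hγ : γ ^ p = c) (hπ : π = γ - c)
    (hβ : p * β = π ^ (p - 1)) (ht : c ^ (p - 1) - 1 = p ^ 2 * t) (n : ℕ) :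
    ∃ g ∈ Algebra.adjoin ℤ {γ}, ∃ o ∈ integralClosure ℤ K,
      β ^ (n + 1) = (-1) ^ n * β + π * g + p * o := by
  have hp3 : 3 ≤ p := by obtain ⟨k, hk⟩ := hp2; have := hp.one_lt; lia
  obtain ⟨h, hh, w, hw, hβπ, hβ2⟩ := exists_mul_relations hp hp2 hγ hπ hβ ht
  have hβO : β ∈ integralClosure ℤ K := isIntegral_beta hp hp2 hγ hπ hβ ht
  have hGO := adjoin_le_integralClosure (isIntegral_of_pow_eq hp hγ)
  have hπG := translate_mem_adjoin hπ
  set κ : ℤ := ((p - 1) / 2 : ℕ) * c ^ (p - 2)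
  have hwG : w ∈ Algebra.adjoin ℤ {γ} := hw ▸ add_mem (add_mem (pow_mem (intCast_mem _ c) _)
    (mul_mem (intCast_mem _ _) hπG)) (mul_mem (pow_mem hπG _) hh)
  have hctG : (c * t : K) ∈ Algebra.adjoin ℤ {γ} := mul_mem (intCast_mem _ c) (intCast_mem _ t)
  have hκG : (κ + π * h : K) ∈ Algebra.adjoin ℤ {γ} :=
    add_mem (intCast_mem _ κ) (mul_mem hπG hh)
  have ht' : (c : K) ^ (p - 1) - 1 = p ^ 2 * t := by
    exact_mod_cast congrArg (Int.cast : ℤ → K) ht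
  induction n with
  | zero => exact ⟨0, zero_mem _, 0, zero_mem _, by simp⟩
  | succ n ih =>
    obtain ⟨g, hg, o, ho, hn⟩ := ih
    refine ⟨(-1) ^ n * ((κ + π * h) * w - c * t * π ^ (p - 3)) - w * g,
      sub_mem (mul_mem (pow_mem (neg_mem (one_mem _)) _) (sub_mem (mul_mem hκG hwG)
        (mul_mem hctG (pow_mem hπG _)))) (mul_mem hwG hg),
      (-1) ^ n * ((κ + π * h) * (c * t) - p * t * β) - c * t * g + β * o,
      add_mem (sub_mem (mul_mem (pow_mem (neg_mem (one_mem _)) _) (sub_mem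
        (hGO (mul_mem hκG hctG)) (mul_mem (mul_mem (natCast_mem _ p) (intCast_mem _ t)) hβO)))
        (hGO (mul_mem hctG hg))) (mul_mem hβO ho), ?_⟩
    have hπ3 : π ^ (p - 2) = π * π ^ (p - 3) := by rw [← pow_succ']; congr 1; lia
    rw [hπ3] at hβ2
    rw [pow_succ, hn]
    linear_combination (-1) ^ n * hβ2 - (-1) ^ n * β * hw - (-1) ^ n * (κ + π * h) * hβπ
      + g * hβπ - (-1) ^ n * β * ht'

/-- Raising to the power `p - 1` and substituting `π ^ (p - 1) = p β` leaves `n ^ (p - 1) β ^ (p -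
2) ∈ p 𝓞`. Since `β ^ (p - 2)` has trace `≡ ± 1` mod `p`, taking traces gives the result. -/
theorem dvd_of_intCast_mul_pow_eq (hp : p.Prime) (hp2 : Odd p) (hfin : Module.finrank ℚ K = p)
    (hγ : γ ^ p = c) (hmin : minpoly ℚ γ = X ^ p - C (c : ℚ)) (hπ : π = γ - c)
    (hβ : p * β = π ^ (p - 1)) (ht : c ^ (p - 1) - 1 = p ^ 2 * t) {n : ℤ} {o : K}
    (ho : o ∈ integralClosure ℤ K) (hn : n * π ^ (p - 2) = p * o) : (p : ℤ) ∣ n := by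
  have hp3 : 3 ≤ p := by obtain ⟨k, hk⟩ := hp2; have := hp.one_lt; lia
  have hp0 : (p : K) ≠ 0 := by exact_mod_cast hp.ne_zero
  have hpP := Nat.prime_iff_prime_int.mp hp
  have hπG := translate_mem_adjoin hπ
  have h1 : (n : K) ^ (p - 1) * β ^ (p - 2) = p * o ^ (p - 1) := by
    refine mul_left_cancel₀ (pow_ne_zero (p - 2) hp0) ?_
    have h2 := congrArg (· ^ (p - 1)) hn
    simp only [mul_pow] at h2
    rw [← pow_mul, mul_comm (p - 2), pow_mul, ← hβ, mul_pow,
      show (p : K) ^ (p - 1) = p ^ (p - 2) * p by rw [← pow_succ]; congr 1; lia] at h2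
    linear_combination h2
  obtain ⟨g, hg, y, hy, hpow⟩ := exists_pow_beta_eq hp hp2 hγ hπ hβ ht (p - 3)
  rw [show p - 3 + 1 = p - 2 by lia] at hpow
  obtain ⟨m₁, hm₁⟩ := trace_adjoin_of_radical hp hfin hγ hmin (mul_mem hπG hg)
  obtain ⟨m₂, hm₂⟩ := exists_trace_eq_of_isIntegral hy
  obtain ⟨m₃, hm₃⟩ := exists_trace_eq_of_isIntegral (pow_mem ho (p - 1))
  have hβtr := trace_beta_of_radical hp hp2 hfin hγ hmin hπ hβ
  have h3 : ((n ^ (p - 1) : ℤ) : K) * (((-1) ^ (p - 3) : ℤ) * β + π * g + (p : ℤ) * y) =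
      (p : ℤ) * o ^ (p - 1) := by
    push_cast
    rw [← hpow, h1]
  have h4 := congrArg (Algebra.trace ℚ K) h3
  rw [trace_intCast_mul, trace_intCast_mul, map_add, map_add, trace_intCast_mul,
    trace_intCast_mul, hm₁, hm₂, hm₃, hβtr] at h4
  have h5 : n ^ (p - 1) * ((-1) ^ (p - 3) * c ^ (p - 1) + p * m₁ + p * m₂) = p * m₃ := by
    exact_mod_cast h4
  have h6 : (p : ℤ) ∣ n ^ (p - 1) * (-1) ^ (p - 3) :=
    ⟨m₃ - n ^ (p - 1) * m₁ - n ^ (p - 1) * m₂ - n ^ (p - 1) * (-1) ^ (p - 3) * (p * t), by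
      linear_combination h5 - n ^ (p - 1) * (-1) ^ (p - 3) * ht⟩
  rcases hpP.dvd_or_dvd h6 with h | h
  · exact hpP.dvd_of_dvd_pow h
  · have := hpP.dvd_of_dvd_pow h
    rw [dvd_neg] at this
    exact absurd this hpP.not_dvd_one

/-- The ring `ℤ[β, γ]` is maximal at `p`. -/
theorem mem_adjoin_of_mul_mem (hp : p.Prime) (hp2 : Odd p) (hfin : Module.finrank ℚ K = p)
    (hγ : γ ^ p = c) (hmin : minpoly ℚ γ = X ^ p - C (c : ℚ)) (hπ : π = γ - c)
    (hβ : p * β = π ^ (p - 1)) (ht : c ^ (p - 1) - 1 = p ^ 2 * t) {z : K}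
    (hz : z ∈ integralClosure ℤ K)
    (hpz : p * z ∈ Algebra.adjoin ℤ {β} ⊔ Algebra.adjoin ℤ {γ}) :
    z ∈ Algebra.adjoin ℤ {β} ⊔ Algebra.adjoin ℤ {γ} := by
  have hp3 : 3 ≤ p := by obtain ⟨k, hk⟩ := hp2; have := hp.one_lt; lia
  have hp0 : (p : K) ≠ 0 := by exact_mod_cast hp.ne_zero
  have hpP := Nat.prime_iff_prime_int.mp hp
  have hπG := translate_mem_adjoin hπ
  have hGO := adjoin_le_integralClosure (isIntegral_of_pow_eq hp hγ)
  have hβO : β ∈ integralClosure ℤ K := isIntegral_beta hp hp2 hγ hπ hβ ht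
  rw [mem_adjoin_sup_adjoin_iff hp hp2 hγ hπ hβ ht] at hpz ⊢
  obtain ⟨g, hg, b, hb⟩ := hpz
  -- Compare traces: those of `p z` and `g` lie in `pℤ`, and that of `β` is `≡ 1` mod `p`.
  have hpb : (p : ℤ) ∣ b := by
    obtain ⟨m₁, hm₁⟩ := trace_adjoin_of_radical hp hfin hγ hmin hg
    obtain ⟨m₂, hm₂⟩ := exists_trace_eq_of_isIntegral hz
    have h1 := congrArg (Algebra.trace ℚ K) hb
    rw [← Int.cast_natCast p, trace_intCast_mul, map_add, trace_intCast_mul, hm₁, hm₂,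
      trace_beta_of_radical hp hp2 hfin hγ hmin hπ hβ] at h1
    have h2 : p * m₂ = p * m₁ + b * c ^ (p - 1) := by exact_mod_cast h1
    exact ⟨m₂ - m₁ - b * (p * t), by linear_combination -h2 - b * ht⟩
  obtain ⟨b, rfl⟩ := hpb
  -- Modulo `p ℤ[γ]` the element is pushed into ever higher powers of `π`: the constant term `n` of
  -- `h` is divisible by `p`, as seen after multiplying by `π ^ (p - 2 - k)`. At `k = p - 1` the
  -- power becomes `p β`, and `p` cancels.
  have key : ∀ k ≤ p - 1, ∃ h ∈ Algebra.adjoin ℤ {γ}, ∃ g' ∈ Algebra.adjoin ℤ {γ},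
      p * (z - b * β) = π ^ k * h + p * g' := by
    intro k
    induction k with
    | zero => exact fun _ => ⟨g, hg, 0, zero_mem _, by push_cast at hb; linear_combination hb⟩
    | succ k ih =>
      intro hk
      obtain ⟨h, hh, g', hg', hz'⟩ := ih (by lia)
      obtain ⟨n, h', hh', rfl⟩ := exists_eq_intCast_add_mul hπ hh
      obtain ⟨n, rfl⟩ := dvd_of_intCast_mul_pow_eq hp hp2 hfin hγ hmin hπ hβ ht (n := n)
        (o := (z - b * β - g') * π ^ (p - 2 - k) - β * h')
        (sub_mem (mul_mem (sub_mem (sub_mem hz (mul_mem (intCast_mem _ b) hβO)) (hGO hg'))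
          (pow_mem (hGO hπG) _)) (mul_mem hβO (hGO hh'))) (by
          have e1 : π ^ (p - 2) = π ^ k * π ^ (p - 2 - k) := by rw [← pow_add]; congr 1; lia
          have e2 : π ^ k * π * π ^ (p - 2 - k) = p * β := by
            rw [hβ, ← pow_succ, ← pow_add]; congr 1; lia
          rw [e1]
          linear_combination -π ^ (p - 2 - k) * hz' - h' * e2)
      exact ⟨h', hh', g' + n * π ^ k, add_mem hg' (mul_mem (intCast_mem _ n) (pow_mem hπG _)),
        by rw [hz', pow_succ]; push_cast; ring⟩
  obtain ⟨h, hh, g', hg', hz'⟩ := key (p - 1) le_rfl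
  obtain ⟨e, he, n, hn⟩ := beta_mul_mem hp hp2 hγ hπ hβ ht hh
  refine ⟨e + g', add_mem he hg', b + n, mul_left_cancel₀ hp0 ?_⟩
  rw [← hβ] at hz'
  push_cast
  linear_combination hz' + p * hn

/-- The discriminant of `ℤ[γ]` is `± p ^ p c ^ (p - 1)`, and maximality at `p` strips off `p ^ p`
one factor at a time. -/
theorem smul_mem_adjoin_sup_adjoin (hp : p.Prime) (hp2 : Odd p) (hfin : Module.finrank ℚ K = p)
    (hγ : γ ^ p = c) (hmin : minpoly ℚ γ = X ^ p - C (c : ℚ)) (hπ : π = γ - c)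
    (hβ : p * β = π ^ (p - 1)) (ht : c ^ (p - 1) - 1 = p ^ 2 * t) {z : K}
    (hz : z ∈ integralClosure ℤ K) :
    (c ^ (p - 1)) • z ∈ Algebra.adjoin ℤ {β} ⊔ Algebra.adjoin ℤ {γ} := by
  have hdesc : ∀ k : ℕ, ∀ y ∈ integralClosure ℤ K,
      p ^ k * y ∈ Algebra.adjoin ℤ {β} ⊔ Algebra.adjoin ℤ {γ} →
      y ∈ Algebra.adjoin ℤ {β} ⊔ Algebra.adjoin ℤ {γ} := by
    intro k
    induction k with
    | zero => intro y _ h; simpa using h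
    | succ k ih =>
      intro y hy h
      refine ih y hy (mem_adjoin_of_mul_mem hp hp2 hfin hγ hmin hπ hβ ht
        (mul_mem (pow_mem (natCast_mem _ p) _) hy) ?_)
      rwa [← mul_assoc, ← pow_succ']
  obtain ⟨pb, hpb⟩ := exists_powerBasis_gen_eq (x := γ) (by
    rw [hmin, natDegree_X_pow_sub_C, hfin])
  have hint : IsIntegral ℤ pb.gen := hpb ▸ isIntegral_of_pow_eq hp hγ
  have hd := Algebra.discr_mul_isIntegral_mem_adjoin ℚ hint hz
  rw [discr_powerBasis_of_radical hp2 hfin hγ hmin 0 pb (by simp [hpb]), hpb] at hd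
  refine hdesc p _ (Subalgebra.zsmul_mem _ hz _) (le_sup_right (a := Algebra.adjoin ℤ {β}) ?_)
  have h2 : (p : K) ^ p * c ^ (p - 1) • z = ((-1) ^ ((p - 1) / 2) : ℤ) •
      (((-1) ^ ((p - 1) / 2) * (p : ℚ) ^ p * (c : ℚ) ^ (p - 1)) • z) := by
    rw [Algebra.smul_def ((-1) ^ ((p - 1) / 2) * (p : ℚ) ^ p * (c : ℚ) ^ (p - 1))]
    have h3 : ((-1) ^ ((p - 1) / 2) * (-1) ^ ((p - 1) / 2) : K) = 1 := by
      rw [← mul_pow]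
      simp
    simp only [zsmul_eq_mul]
    push_cast
    simp only [map_intCast]
    linear_combination (-(p : K) ^ p * c ^ (p - 1) * z) * h3
  rw [h2]
  exact Subalgebra.zsmul_mem _ hd _

end

/-! ### Generation at `p` by `β` alone when `p ≥ 5` -/

section

open Polynomial

variable {K : Type*} [Field K] [NumberField K] {p : ℕ} {c t : ℤ} {γ π β : K}

/-- Since `p ≥ 5`, the term `c t π ^ (p - 2)` of `β ^ 2` is divisible by `π ^ 2` and leaves the
coefficient of `π` unchanged. -/
theorem exists_sq_beta_add_beta_eq (hp : p.Prime) (hp2 : Odd p) (hp5 : 5 ≤ p) (hγ : γ ^ p = c)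
    (hπ : π = γ - c) (hβ : p * β = π ^ (p - 1)) (ht : c ^ (p - 1) - 1 = p ^ 2 * t) :
    ∃ h ∈ Algebra.adjoin ℤ {γ}, ∃ y ∈ Algebra.adjoin ℤ {β} ⊔ Algebra.adjoin ℤ {γ},
      β ^ 2 + β = (((p - 1) / 2 : ℕ) * c ^ (p - 2) : ℤ) * π + π ^ 2 * h + p * y := by
  obtain ⟨h, hh, w, hw, hβπ, hβ2⟩ := exists_mul_relations hp hp2 hγ hπ hβ ht
  have hπG := translate_mem_adjoin hπ
  set κ : ℤ := ((p - 1) / 2 : ℕ) * c ^ (p - 2)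
  have hwG : w ∈ Algebra.adjoin ℤ {γ} := hw ▸ add_mem (add_mem (pow_mem (intCast_mem _ c) _)
    (mul_mem (intCast_mem _ _) hπG)) (mul_mem (pow_mem hπG _) hh)
  have hctG : (c * t : K) ∈ Algebra.adjoin ℤ {γ} := mul_mem (intCast_mem _ c) (intCast_mem _ t)
  have hκG : (κ + π * h : K) ∈ Algebra.adjoin ℤ {γ} :=
    add_mem (intCast_mem _ κ) (mul_mem hπG hh)
  have ht' : (c : K) ^ (p - 1) - 1 = p ^ 2 * t := by
    exact_mod_cast congrArg (Int.cast : ℤ → K) ht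
  have hπ4 : π ^ (p - 2) = π ^ 2 * π ^ (p - 4) := by rw [← pow_add]; congr 1; lia
  have hβC : β ∈ Algebra.adjoin ℤ {β} ⊔ Algebra.adjoin ℤ {γ} :=
    le_sup_left (a := Algebra.adjoin ℤ {β}) (Algebra.self_mem_adjoin_singleton ℤ β)
  have hGC : Algebra.adjoin ℤ {γ} ≤ Algebra.adjoin ℤ {β} ⊔ Algebra.adjoin ℤ {γ} := le_sup_right
  refine ⟨κ * (κ + π * h) + h * w - c * t * π ^ (p - 4),
    sub_mem (add_mem (mul_mem (intCast_mem _ κ) hκG) (mul_mem hh hwG))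
      (mul_mem hctG (pow_mem hπG _)),
    (κ + π * h) * (c * t) + p * κ * t * π - p * t * β,
    sub_mem (hGC (add_mem (mul_mem hκG hctG) (mul_mem (mul_mem (mul_mem (natCast_mem _ p)
      (intCast_mem _ κ)) (intCast_mem _ t)) hπG)))
      (mul_mem (mul_mem (natCast_mem _ p) (intCast_mem _ t)) hβC), ?_⟩
  rw [hπ4] at hβ2
  linear_combination hβ2 - β * hw - (κ + π * h) * hβπ - β * ht' + κ * π * hw + κ * π * ht'

theorem not_dvd_of_wieferich (hp : p.Prime) (hp2 : Odd p) (ht : c ^ (p - 1) - 1 = p ^ 2 * t) :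
    ¬ (p : ℤ) ∣ c := by
  intro h
  have hp3 : 3 ≤ p := by obtain ⟨k, hk⟩ := hp2; have := hp.one_lt; lia
  have h1 : (p : ℤ) ∣ c ^ (p - 1) := dvd_pow h (by lia)
  refine (Nat.prime_iff_prime_int.mp hp).not_dvd_one ?_
  have h2 : (1 : ℤ) = c ^ (p - 1) - p * (p * t) := by linear_combination -ht
  rw [h2]
  exact dvd_sub h1 (dvd_mul_right _ _)

/-- For `p ≥ 5`, the element `β` alone generates `ℤ[β, γ]` up to index prime to `p`. -/
theorem locallyLE_adjoin_beta (hp : p.Prime) (hp2 : Odd p) (hp5 : 5 ≤ p) (hγ : γ ^ p = c)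
    (hπ : π = γ - c) (hβ : p * β = π ^ (p - 1)) (ht : c ^ (p - 1) - 1 = p ^ 2 * t) :
    LocallyLE p (Subalgebra.toSubmodule (Algebra.adjoin ℤ {β} ⊔ Algebra.adjoin ℤ {γ}))
      (Subalgebra.toSubmodule (Algebra.adjoin ℤ {β})) := by
  have hpP := Nat.prime_iff_prime_int.mp hp
  have hπG := translate_mem_adjoin hπ
  obtain ⟨h, hh, y₀, hy₀, hsq⟩ := exists_sq_beta_add_beta_eq hp hp2 hp5 hγ hπ hβ ht
  set κ : ℤ := ((p - 1) / 2 : ℕ) * c ^ (p - 2) with hκ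
  have hpκ : IsCoprime κ (p : ℤ) := by
    refine ((Prime.coprime_iff_not_dvd hpP).mpr fun hd => ?_).symm
    rcases hpP.dvd_or_dvd hd with hd | hd
    · have := Nat.le_of_dvd (by lia) (Int.natCast_dvd_natCast.mp hd)
      lia
    · exact not_dvd_of_wieferich hp hp2 ht (hpP.dvd_of_dvd_pow hd)
  set B := Algebra.adjoin ℤ {β} with hB
  set G := Algebra.adjoin ℤ {γ} with hG
  have hBC : B ≤ B ⊔ G := le_sup_left
  have hGC : G ≤ B ⊔ G := le_sup_right
  have hβB : β ∈ B := Algebra.self_mem_adjoin_singleton ℤ β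
  -- `S` is the subring `ℤ[β] + p ℤ[β, γ]`; the aim is that it is all of `ℤ[β, γ]`.
  let S : K → Prop := fun x => ∃ b ∈ B, ∃ y ∈ B ⊔ G, x = b + p * y
  have hSadd : ∀ x x', S x → S x' → S (x + x') := by
    rintro _ _ ⟨b, hb, y, hy, rfl⟩ ⟨b', hb', y', hy', rfl⟩
    exact ⟨b + b', add_mem hb hb', y + y', add_mem hy hy', by ring⟩
  have hSmul : ∀ x x', S x → S x' → S (x * x') := by
    rintro _ _ ⟨b, hb, y, hy, rfl⟩ ⟨b', hb', y', hy', rfl⟩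
    exact ⟨b * b', mul_mem hb hb', b * y' + y * b' + p * y * y',
      add_mem (add_mem (mul_mem (hBC hb) hy') (mul_mem hy (hBC hb')))
        (mul_mem (mul_mem (natCast_mem _ p) hy) hy'), by ring⟩
  have hSB : ∀ x ∈ B, S x := fun x hx => ⟨x, hx, 0, zero_mem _, by simp⟩
  have hSp : ∀ y ∈ B ⊔ G, S (p * y) := fun y hy => ⟨0, zero_mem _, y, hy, by simp⟩
  have hSη : S (κ * π + π ^ 2 * h) :=
    ⟨β ^ 2 + β, add_mem (pow_mem hβB _) hβB, -y₀, neg_mem hy₀, by rw [hsq]; ring⟩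
  have hηpow : ∀ k : ℕ, ∃ h' ∈ G, (κ * π + π ^ 2 * h) ^ k = κ ^ k * π ^ k + π ^ (k + 1) * h' := by
    intro k
    induction k with
    | zero => exact ⟨0, zero_mem _, by simp⟩
    | succ k ih =>
      obtain ⟨h', hh', hk⟩ := ih
      exact ⟨κ ^ k * h + h' * κ + h' * π * h, add_mem (add_mem (mul_mem (pow_mem (intCast_mem _ κ) _)
        hh) (mul_mem hh' (intCast_mem _ κ))) (mul_mem (mul_mem hh' hπG) hh),
        by rw [pow_succ, hk]; ring⟩
  have hSηpow : ∀ k : ℕ, S ((κ * π + π ^ 2 * h) ^ k) := by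
    intro k
    induction k with
    | zero => exact hSB _ (by rw [pow_zero]; exact one_mem _)
    | succ k ih => rw [pow_succ]; exact hSmul _ _ ih hSη
  -- Descending induction on the power of `π`, from `π ^ (p - 1) = p β`. The element `η = κ π + π ^
  -- 2 h` of `S` has `η ^ m ≡ κ ^ m π ^ m` modulo `π ^ (m + 1)`, and `κ` is invertible mod `p`.
  have key : ∀ k ≤ p - 1, ∀ g ∈ G, S (π ^ (p - 1 - k) * g) := by
    intro k
    induction k with
    | zero =>
      intro _ g hg
      rw [Nat.sub_zero, ← hβ, mul_assoc]
      exact hSp _ (mul_mem (hBC hβB) (hGC hg))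
    | succ k ih =>
      intro hk g hg
      have ih := ih (by lia)
      set m := p - 1 - (k + 1)
      rw [show p - 1 - k = m + 1 by lia] at ih
      have hπm : S (π ^ m) := by
        obtain ⟨h', hh', hm⟩ := hηpow m
        obtain ⟨x, y, hxy⟩ := hpκ.pow_left (m := m)
        have h1 : S (κ ^ m * π ^ m) := by
          have := hSadd _ _ (hSηpow m) (ih (-h') (neg_mem hh'))
          rwa [hm, show (κ : K) ^ m * π ^ m + π ^ (m + 1) * h' + π ^ (m + 1) * -h' =
            κ ^ m * π ^ m by ring] at this
        have h2 := hSadd _ _ (hSmul _ _ (hSB _ (intCast_mem B x)) h1)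
          (hSp (y * π ^ m) (hGC (mul_mem (intCast_mem _ y) (pow_mem hπG _))))
        have h3 : (x * κ ^ m + y * p : K) = 1 := by
          exact_mod_cast congrArg (Int.cast : ℤ → K) hxy
        rwa [show (x : K) * (κ ^ m * π ^ m) + p * (y * π ^ m) = π ^ m by
          linear_combination π ^ m * h3] at h2
      obtain ⟨n, g', hg', rfl⟩ := exists_eq_intCast_add_mul hπ hg
      have := hSadd _ _ (hSmul _ _ (hSB _ (intCast_mem B n)) hπm) (ih g' hg')
      rwa [show (n : K) * π ^ m + π ^ (m + 1) * g' = π ^ m * (n + π * g') by ring] at this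
  have hSG : ∀ g ∈ G, S g := fun g hg => by simpa using key (p - 1) le_rfl g hg
  let R := Subalgebra.toSubmodule (B ⊔ G)
  have hSR : R ≤ Subalgebra.toSubmodule B ⊔ Ideal.span {(p : ℤ)} • R := by
    intro x hx
    have hSx : S x := by
      obtain ⟨g, hg, n, rfl⟩ := (mem_adjoin_sup_adjoin_iff hp hp2 hγ hπ hβ ht).mp hx
      exact hSadd _ _ (hSG g hg) (hSB _ (mul_mem (intCast_mem _ n) hβB))
    obtain ⟨b, hb, y, hy, rfl⟩ := hSx
    refine Submodule.add_mem_sup hb ?_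
    rw [show (p : K) * y = (p : ℤ) • y by simp]
    exact Submodule.smul_mem_smul (Ideal.mem_span_singleton_self _) hy
  have hRO : R ≤ ringOfIntegersSubmodule K :=
    Subalgebra.toSubmodule.monotone (sup_le
      (adjoin_le_integralClosure (isIntegral_beta hp hp2 hγ hπ hβ ht))
      (adjoin_le_integralClosure (isIntegral_of_pow_eq hp hγ)))
  have hRfg : R.FG := by
    have : IsNoetherian ℤ (ringOfIntegersSubmodule K) :=
      isNoetherian_of_fg_of_noetherian _ ringOfIntegersSubmodule_fg
    exact isNoetherian_submodule.mp this R hRO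
  -- Nakayama's lemma: `R = ℤ[β] + p R` yields `r ≡ 1` mod `p` with `r R ⊆ ℤ[β]`.
  obtain ⟨r, hr, hrR⟩ := Submodule.exists_sub_one_mem_and_smul_le_of_fg_of_le_sup hRfg le_rfl hSR
  rw [Ideal.mem_span_singleton] at hr
  refine fun x hx => ⟨r, fun hd => hpP.not_dvd_one ?_, hrR (Submodule.smul_mem_pointwise_smul x r R hx)⟩
  rw [show (1 : ℤ) = r - (r - 1) by ring]
  exact dvd_sub hd hr

end

/-! ### Passing between `a` and `c`, and between different `γ_j` -/

section

/-- `q ^ (p (p - 1)) ≡ 1` mod `p ^ 2` by Euler's theorem, so dividing by `q ^ (p v)` does not affect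
the condition. -/
theorem isWieferich_mul_pow {p : ℕ} (hp : p.Prime) {a c : ℤ} {q u v : ℕ}
    (hq : q.Coprime p) (h : c * (q : ℤ) ^ (p * v) = a ^ u) (hW : IsWieferich p a) :
    IsWieferich p c := by
  have h1 : a ^ (p - 1) ≡ 1 [ZMOD (p : ℤ) ^ 2] := (Int.modEq_iff_dvd.mpr hW).symm
  have h2 : (q : ℤ) ^ (p * (p - 1)) ≡ 1 [ZMOD (p : ℤ) ^ 2] := by
    have := Nat.ModEq.pow_totient (n := p ^ 2) (hq.pow_right 2)
    rw [Nat.totient_prime_pow_succ hp, pow_one] at this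
    exact_mod_cast Int.natCast_modEq_iff.mpr this
  have h3 : c ^ (p - 1) * ((q : ℤ) ^ (p * (p - 1))) ^ v = (a ^ (p - 1)) ^ u := by
    rw [← pow_mul a, mul_comm (p - 1), pow_mul a, ← h, mul_pow, ← pow_mul, ← pow_mul]
    congr 2
    ring
  have h4 : c ^ (p - 1) ≡ 1 [ZMOD (p : ℤ) ^ 2] := by
    have h5 := (h2.pow v).mul_left (c ^ (p - 1))
    rw [h3, one_pow, mul_one] at h5
    simpa using h5.symm.trans (h1.pow u)
  exact Int.modEq_iff_dvd.mp h4.symm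

theorem exists_eq_prime_pow_mul {m : ℕ} {q e : Fin m → ℕ} (hq : ∀ j, (q j).Prime)
    (hqinj : Function.Injective q) {a : ℤ} (ha : a.natAbs = ∏ j, q j ^ e j) (j : Fin m) :
    ∃ r : ℤ, a = (q j : ℤ) ^ e j * r ∧ ¬ (q j : ℤ) ∣ r := by
  have hdvd : (q j : ℤ) ^ e j ∣ a := by
    have h := ha ▸ Finset.dvd_prod_of_mem (fun j => q j ^ e j) (Finset.mem_univ j)
    exact_mod_cast Int.natCast_dvd.mpr h
  obtain ⟨r, hr⟩ := hdvd
  refine ⟨r, hr, fun hd => ?_⟩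
  have h1 : r.natAbs = ∏ k ∈ Finset.univ.erase j, q k ^ e k := by
    refine Nat.eq_of_mul_eq_mul_left (pow_pos (hq j).pos (e j)) ?_
    rw [Finset.mul_prod_erase _ (fun k => q k ^ e k) (Finset.mem_univ j), ← ha, hr,
      Int.natAbs_mul, Int.natAbs_pow, Int.natAbs_natCast]
  have h2 : q j ∣ ∏ k ∈ Finset.univ.erase j, q k ^ e k := h1 ▸ Int.natCast_dvd.mp hd
  obtain ⟨k, hk, hd'⟩ := ((hq j).prime.dvd_finsetProd_iff _).mp h2
  exact Finset.ne_of_mem_erase hk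
    (hqinj ((Nat.prime_dvd_prime_iff_eq (hq j) (hq k)).mp ((hq j).dvd_of_dvd_pow hd'))).symm

variable {K : Type*} [Field K]

theorem prod_toSubmodule {ι : Type*} (s : Finset ι) (S : ι → Subalgebra ℤ K) :
    ∏ j ∈ s, Subalgebra.toSubmodule (S j) = Subalgebra.toSubmodule (s.sup S) := by
  classical
  induction s using Finset.induction_on with
  | empty => rw [Finset.prod_empty, Finset.sup_empty, Algebra.toSubmodule_bot]
  | insert j s hj ih =>
    rw [Finset.prod_insert hj, Finset.sup_insert, ih, Subalgebra.mul_toSubmodule]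

theorem locallyLE_adjoin_of_mul_mem {ℓ : ℕ} (hℓ : ℓ.Prime) {t : ℤ} (ht : ¬ (ℓ : ℤ) ∣ t) {x : K}
    {A : Subalgebra ℤ K} (hx : t * x ∈ A) :
    LocallyLE ℓ (Subalgebra.toSubmodule (Algebra.adjoin ℤ {x})) (Subalgebra.toSubmodule A) := by
  have hpow : ∀ n : ℕ, ¬ (ℓ : ℤ) ∣ t ^ n := fun n h =>
    ht ((Nat.prime_iff_prime_int.mp hℓ).dvd_of_dvd_pow h)
  have key : ∀ y ∈ Algebra.adjoin ℤ {x}, ∃ n : ℕ, (t : K) ^ n * y ∈ A := by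
    intro y hy
    induction hy using Algebra.adjoin_induction with
    | mem y hy => exact ⟨1, by rwa [pow_one, Set.mem_singleton_iff.mp hy]⟩
    | algebraMap r => exact ⟨0, by simp⟩
    | add y z _ _ hy hz =>
      obtain ⟨n, hn⟩ := hy
      obtain ⟨k, hk⟩ := hz
      refine ⟨n + k, ?_⟩
      rw [show (t : K) ^ (n + k) * (y + z) = t ^ k * (t ^ n * y) + t ^ n * (t ^ k * z) by ring]
      exact add_mem (mul_mem (pow_mem (intCast_mem _ t) _) hn)
        (mul_mem (pow_mem (intCast_mem _ t) _) hk)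
    | mul y z _ _ hy hz =>
      obtain ⟨n, hn⟩ := hy
      obtain ⟨k, hk⟩ := hz
      refine ⟨n + k, ?_⟩
      rw [show (t : K) ^ (n + k) * (y * z) = (t ^ n * y) * (t ^ k * z) by ring]
      exact mul_mem hn hk
  intro y hy
  obtain ⟨n, hn⟩ := key y hy
  exact ⟨t ^ n, hpow n, by simpa using hn⟩

variable [CharZero K]

theorem radGamma_pow {p : ℕ} {a c : ℤ} {α : K} (hα : α ^ p = a) {q u v : ℕ} (hq : q.Prime)
    (h : c * (q : ℤ) ^ (p * v) = a ^ u) : radGamma α q u v ^ p = c := by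
  have hq0 : (q : K) ≠ 0 := by exact_mod_cast hq.ne_zero
  have h' : (c : K) * (q : K) ^ (p * v) = a ^ u := by
    exact_mod_cast congrArg (Int.cast : ℤ → K) h
  rw [radGamma, div_pow, ← pow_mul, mul_comm u, pow_mul, hα, ← h', ← pow_mul, mul_comm v]
  exact mul_div_cancel_right₀ _ (pow_ne_zero _ hq0)

theorem radC_eq {p : ℕ} {a c : ℤ} {q u v : ℕ} (hq : q.Prime)
    (h : c * (q : ℤ) ^ (p * v) = a ^ u) : radC K p a q u v = c := by
  have hq0 : (q : K) ≠ 0 := by exact_mod_cast hq.ne_zero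
  have h' : (c : K) * (q : K) ^ (p * v) = a ^ u := by
    exact_mod_cast congrArg (Int.cast : ℤ → K) h
  rw [radC, ← h']
  exact mul_div_cancel_right₀ _ (pow_ne_zero _ hq0)

/-- Since `e' u' = p v' + 1`, the element `q' ^ (v' e') γ' ^ e'` equals `a ^ v' α`; its `u`-th power
is a multiple of `α ^ u = q ^ v γ`. -/
theorem mul_radGamma_mem_adjoin {p : ℕ} {a : ℤ} {α : K} (hα : α ^ p = a) {q u v q' e' u' v' : ℕ}
    (hq : q.Prime) (hq' : q'.Prime) (h : e' * u' = p * v' + 1) :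
    ((a ^ (v' * u) * (q : ℤ) ^ v : ℤ) : K) * radGamma α q u v ∈
      Algebra.adjoin ℤ {radGamma α q' u' v'} := by
  have hq0 : (q : K) ^ v ≠ 0 := pow_ne_zero _ (by exact_mod_cast hq.ne_zero)
  have hq0' : (q' : K) ^ (v' * e') ≠ 0 := pow_ne_zero _ (by exact_mod_cast hq'.ne_zero)
  have h1 : (q' : K) ^ (v' * e') * radGamma α q' u' v' ^ e' = a ^ v' * α := by
    rw [radGamma, div_pow, ← pow_mul, ← pow_mul, mul_div_cancel₀ _ hq0', mul_comm u', h, pow_succ,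
      pow_mul, hα]
  have h2 : ((a ^ (v' * u) * (q : ℤ) ^ v : ℤ) : K) * radGamma α q u v =
      ((q' : K) ^ (v' * e') * radGamma α q' u' v' ^ e') ^ u := by
    rw [h1, radGamma]
    push_cast
    field_simp
    ring
  rw [h2]
  exact pow_mem (mul_mem (pow_mem (natCast_mem _ _) _)
    (pow_mem (Algebra.self_mem_adjoin_singleton ℤ _) _)) _

end

/-! ### Assembling the local statements -/

theorem corollary5p3 {K : Type*} [Field K] [NumberField K]
    (p : ℕ) (hp : p.Prime) (hp2 : p ≠ 2)
    (a : ℤ) (m : ℕ) (q e : Fin m → ℕ)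
    (hq : ∀ j, (q j).Prime) (hqinj : Function.Injective q)
    (he : ∀ j, 1 ≤ e j ∧ e j ≤ p - 1)
    (ha : a.natAbs = ∏ j, q j ^ e j)
    (α : K) (hα : α ^ p = (a : K)) (hK : IntermediateField.adjoin ℚ {α} = ⊤)
    (u v : Fin m → ℕ) (hu : ∀ j, 1 ≤ u j ∧ u j ≤ p - 1)
    (huv : ∀ j, e j * u j = p * v j + 1)
    (hW : IsWieferich p a) (i : Fin m) :
    -- the decomposition of the ring of integers
    ringOfIntegersSubmodule K =
        intAdjoin (radBeta p a α (q i) (u i) (v i)) *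
          ∏ j, intAdjoin (radGamma α (q j) (u j) (v j)) ∧
    -- the value of the discriminant
    NumberField.discr K =
        (-1) ^ ((p - 1) / 2) * (p : ℤ) ^ (p - 2) * ∏ j, (q j : ℤ) ^ (p - 1) ∧
    -- the discriminant as a greatest common divisor, for `p ≥ 5`
    (5 ≤ p → ∃ (D₀ : ℤ) (D : Fin m → ℤ),
        HasDiscr (intAdjoin (radBeta p a α (q i) (u i) (v i))) D₀ ∧
        (∀ j, HasDiscr (intAdjoin (radGamma α (q j) (u j) (v j))) (D j)) ∧
        Associated (NumberField.discr K) (gcd D₀ (Finset.univ.gcd D))) ∧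
    -- the discriminant as a greatest common divisor, for all `p`
    (∃ E : Fin m → ℤ,
        (∀ j, HasDiscr (intAdjoin (radBeta p a α (q i) (u i) (v i)) *
            intAdjoin (radGamma α (q j) (u j) (v j))) (E j)) ∧
        Associated (NumberField.discr K) (Finset.univ.gcd E)) := by
  have hodd : Odd p := hp.odd_of_ne_two hp2
  have hpP := Nat.prime_iff_prime_int.mp hp
  have hp0 : (p : K) ≠ 0 := by exact_mod_cast hp.ne_zero
  have hpa : ¬ (p : ℤ) ∣ a := let ⟨_, ht⟩ := hW; not_dvd_of_wieferich hp hodd ht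
  have hqa : ∀ j, (q j : ℤ) ∣ a := fun j => Int.natCast_dvd.mpr (ha ▸
    (dvd_pow_self (q j) (by have := he j; lia)).trans
      (Finset.dvd_prod_of_mem (fun j => q j ^ e j) (Finset.mem_univ j)))
  have hqp : ∀ j, (q j).Coprime p := fun j => (Nat.coprime_primes (hq j) hp).mpr
    fun h => hpa (h ▸ hqa j)
  have hdata : ∀ j, ∃ c g t : ℤ, c * (q j : ℤ) ^ (p * v j) = a ^ u j ∧ c = q j * g ∧
      ¬ (q j : ℤ) ∣ g ∧ g ∣ a ^ u j ∧ c ^ (p - 1) - 1 = p ^ 2 * t := by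
    intro j
    obtain ⟨r, hr, hqr⟩ := exists_eq_prime_pow_mul hq hqinj ha j
    have hc : (q j * r ^ u j : ℤ) * (q j : ℤ) ^ (p * v j) = a ^ u j := by
      conv_rhs => rw [hr]
      rw [mul_pow, ← pow_mul, huv j]
      ring
    obtain ⟨t, ht⟩ := isWieferich_mul_pow hp (hqp j) hc hW
    exact ⟨_, _, t, hc, rfl, fun h => hqr ((Nat.prime_iff_prime_int.mp (hq j)).dvd_of_dvd_pow h),
      pow_dvd_pow_of_dvd ⟨_, hr.trans (mul_comm _ _)⟩ _, ht⟩
  choose c g t hca hcg hqg hga ht using hdata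
  set γ : Fin m → K := fun j => radGamma α (q j) (u j) (v j) with hγdef
  set β : Fin m → K := fun j => radBeta p a α (q j) (u j) (v j) with hβdef
  have hγ : ∀ j, γ j ^ p = c j := fun j => radGamma_pow hα (hq j) (hca j)
  have hβ : ∀ j, p * β j = (γ j - c j) ^ (p - 1) := fun j => by
    simp only [hβdef, radBeta, radC_eq (hq j) (hca j), hγdef]
    exact mul_div_cancel₀ _ hp0
  have hmin : ∀ j, minpoly ℚ (γ j) = Polynomial.X ^ p - Polynomial.C (c j : ℚ) := fun j =>
    minpoly_rat_of_eisenstein hp (hγ j) (hq j) (hcg j) (hqg j)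
  have hfin : Module.finrank ℚ K = p := by
    refine le_antisymm ?_ ?_
    · rw [← (Field.primitive_element_iff_minpoly_natDegree_eq ℚ α).mp hK]
      have := Polynomial.natDegree_le_of_dvd
        (minpoly.dvd ℚ α (p := Polynomial.X ^ p - Polynomial.C (a : ℚ)) (by simp [hα]))
        (Polynomial.monic_X_pow_sub_C _ hp.ne_zero).ne_zero
      rwa [Polynomial.natDegree_X_pow_sub_C] at this
    · have := minpoly.natDegree_le (A := ℚ) (γ i)
      rwa [hmin i, Polynomial.natDegree_X_pow_sub_C] at this
  let B : Fin m → Subalgebra ℤ K := fun j => Algebra.adjoin ℤ {β j}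
  let G : Fin m → Subalgebra ℤ K := fun j => Algebra.adjoin ℤ {γ j}
  have hBO : ∀ j, B j ≤ integralClosure ℤ K := fun j =>
    adjoin_le_integralClosure (isIntegral_beta hp hodd (hγ j) rfl (hβ j) (ht j))
  have hGO : ∀ j, G j ≤ integralClosure ℤ K := fun j =>
    adjoin_le_integralClosure (isIntegral_of_pow_eq hp (hγ j))
  have hlocG : ∀ j (ℓ : ℕ), ℓ.Prime → ℓ ≠ p → ¬ (ℓ : ℤ) ∣ g j →
      LocallyLE ℓ (ringOfIntegersSubmodule K) (Subalgebra.toSubmodule (G j)) := by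
    intro j ℓ hℓ hℓp hℓg z hz
    refine ⟨p ^ p * g j ^ (p - 1), fun hd => ?_,
      smul_mem_adjoin_of_eisenstein hp hodd hfin (hγ j) (hq j) (hcg j) (hqg j) hz⟩
    have hℓP := Nat.prime_iff_prime_int.mp hℓ
    rcases hℓP.dvd_or_dvd hd with hd | hd
    · exact hℓp ((Nat.prime_dvd_prime_iff_eq hℓ hp).mp
        (Int.natCast_dvd_natCast.mp (hℓP.dvd_of_dvd_pow hd)))
    · exact hℓg (hℓP.dvd_of_dvd_pow hd)
  have hlocBG : ∀ k, LocallyLE p (ringOfIntegersSubmodule K)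
      (Subalgebra.toSubmodule (B k ⊔ G k)) := fun k z hz =>
    ⟨c k ^ (p - 1), fun hd => not_dvd_of_wieferich hp hodd (ht k) (hpP.dvd_of_dvd_pow hd),
      smul_mem_adjoin_sup_adjoin hp hodd hfin (hγ k) (hmin k) rfl (hβ k) (ht k) hz⟩
  -- At `p` the choice of `γ_j` is immaterial: a multiple of `γ_k` by an integer prime to `p` lies
  -- in `ℤ[γ_j]`.
  have hlocp : ∀ k j, LocallyLE p (ringOfIntegersSubmodule K)
      (Subalgebra.toSubmodule (B k ⊔ G j)) := by
    intro k j
    refine (hlocBG k).trans hp fun x hx => ?_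
    obtain ⟨y, hy, n, rfl⟩ :=
      (mem_adjoin_sup_adjoin_iff hp hodd (hγ k) rfl (hβ k) (ht k)).mp hx
    have hT : ¬ (p : ℤ) ∣ a ^ (v j * u k) * (q k : ℤ) ^ v k := by
      intro hd
      rcases hpP.dvd_or_dvd hd with hd | hd
      · exact hpa (hpP.dvd_of_dvd_pow hd)
      · have := (Nat.prime_dvd_prime_iff_eq hp (hq k)).mp
          (Int.natCast_dvd_natCast.mp (hpP.dvd_of_dvd_pow hd))
        exact hpa (this ▸ hqa k)
    obtain ⟨N, hN, hNy⟩ := locallyLE_adjoin_of_mul_mem hp hT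
      (mul_radGamma_mem_adjoin hα (hq k) (hq j) (huv j)) y hy
    refine ⟨N, hN, ?_⟩
    rw [smul_add]
    refine add_mem (le_sup_right (a := B k) hNy) (Subalgebra.zsmul_mem _ ?_ _)
    exact mul_mem (intCast_mem _ n)
      (le_sup_left (a := B k) (Algebra.self_mem_adjoin_singleton ℤ (β k)))
  have hcover : ∀ ℓ : ℕ, ℓ.Prime → ∃ j, ¬ (ℓ : ℤ) ∣ g j := by
    intro ℓ hℓ
    by_cases h : ∃ j, ℓ = q j
    · obtain ⟨j, rfl⟩ := h
      exact ⟨j, hqg j⟩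
    · refine ⟨i, fun hd => h ?_⟩
      have h1 : ℓ ∣ ∏ j, q j ^ e j := ha ▸ Int.natCast_dvd.mp
        ((Nat.prime_iff_prime_int.mp hℓ).dvd_of_dvd_pow (hd.trans (hga i)))
      obtain ⟨j, -, hj⟩ := (hℓ.prime.dvd_finsetProd_iff _).mp h1
      exact ⟨j, (Nat.prime_dvd_prime_iff_eq hℓ (hq j)).mp (hℓ.dvd_of_dvd_pow hj)⟩
  -- `f` is the identity when the discriminant is evaluated, and constantly `i` elsewhere.
  have hloc : ∀ f : Fin m → Fin m, ∀ ℓ : ℕ, ℓ.Prime → ∃ j, ¬ (ℓ : ℤ) ∣ g j ∧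
      LocallyLE ℓ (ringOfIntegersSubmodule K) (Subalgebra.toSubmodule (B (f j) ⊔ G j)) := by
    intro f ℓ hℓ
    obtain ⟨j, hj⟩ := hcover ℓ hℓ
    by_cases h : ℓ = p
    · exact ⟨j, hj, h ▸ hlocp (f j) j⟩
    · exact ⟨j, hj, (hlocG j ℓ hℓ h hj).mono_right
        (Subalgebra.toSubmodule.monotone le_sup_right)⟩
  have hdisc : ∀ k j, ∃ x : ℤ, HasDiscr (Subalgebra.toSubmodule (B k ⊔ G j))
      (x ^ 2 * NumberField.discr K) ∧ ∀ ℓ : ℕ, ℓ.Prime →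
        LocallyLE ℓ (ringOfIntegersSubmodule K) (Subalgebra.toSubmodule (B k ⊔ G j)) →
        ¬ (ℓ : ℤ) ∣ x := fun k j =>
    exists_hasDiscr_of_locallyLE
      (Subalgebra.toSubmodule.monotone (sup_le (hBO k) (hGO j))) hp (hlocp k j)
  choose x hx hxℓ using hdisc
  refine ⟨?_, ?_, ?_, ?_⟩
  · have hM : intAdjoin (β i) * ∏ j, intAdjoin (γ j) =
        Subalgebra.toSubmodule (B i ⊔ Finset.univ.sup G) := by
      rw [← Subalgebra.mul_toSubmodule, ← prod_toSubmodule]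
      rfl
    rw [hM]
    refine le_antisymm (LocallyLE.le_of_forall fun ℓ hℓ => ?_)
      (Subalgebra.toSubmodule.monotone (sup_le (hBO i) (Finset.sup_le fun j _ => hGO j)))
    obtain ⟨j, -, hj⟩ := hloc (fun _ => i) ℓ hℓ
    exact hj.mono_right (Subalgebra.toSubmodule.monotone
      (sup_le_sup_left (Finset.le_sup (Finset.mem_univ j)) _))
  · have hc0 : ∀ j, c j ≠ 0 := fun j h =>
      not_dvd_of_wieferich hp hodd (ht j) (h ▸ dvd_zero _)
    have hQ : ∀ j, (∏ k, (q k : ℤ)) ∣ c j := by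
      intro j
      refine Finset.prod_dvd_of_coprime (fun k _ l _ hkl => ?_) fun k _ => ?_
      · exact Nat.isCoprime_iff_coprime.mpr
          ((Nat.coprime_primes (hq k) (hq l)).mpr fun h => hkl (hqinj h))
      · by_cases hkj : k = j
        · exact hkj ▸ ⟨_, hcg k⟩
        · have hkP := Nat.prime_iff_prime_int.mp (hq k)
          have h1 : (q k : ℤ) ∣ c j * (q j : ℤ) ^ (p * v j) :=
            hca j ▸ dvd_pow (hqa k) (by have := hu j; lia)
          refine (hkP.dvd_or_dvd h1).resolve_right fun h => hkj (hqinj ?_)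
          exact (Nat.prime_dvd_prime_iff_eq (hq k) (hq j)).mp
            (Int.natCast_dvd_natCast.mp (hkP.dvd_of_dvd_pow h))
    choose f hf using hQ
    have hfg : ∀ j, f j ∣ g j := by
      intro j
      refine ⟨∏ k ∈ Finset.univ.erase j, (q k : ℤ), mul_left_cancel₀
        (by exact_mod_cast (hq j).ne_zero : (q j : ℤ) ≠ 0) ?_⟩
      rw [← hcg j, hf j, ← Finset.mul_prod_erase _ _ (Finset.mem_univ j)]
      ring
    set T : ℤ := (-1) ^ ((p - 1) / 2) * (p : ℤ) ^ (p - 2) * ∏ j, (q j : ℤ) ^ (p - 1) with hT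
    -- Two expressions for `disc ℤ[β_j, γ_j]`, with `f j = c j / ∏ q_k`. Both families of square
    -- cofactors have gcd `1`, so `disc K` and `T` agree up to sign.
    have hxT : ∀ j, x j j ^ 2 * NumberField.discr K = (f j ^ ((p - 1) / 2)) ^ 2 * T := by
      intro j
      have h1 := (hx j j).unique (hasDiscr_adjoin_sup_adjoin hp hodd hfin (hγ j) (hmin j) rfl
        (hβ j) (ht j) (hc0 j))
      have h2 : (p - 1) / 2 * 2 = p - 1 := by obtain ⟨k, hk⟩ := hodd; lia
      rw [h1, hT, hf j, mul_pow, Finset.prod_pow, ← pow_mul, h2]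
      ring
    have hDx := associated_gcd_sq_mul Finset.univ (fun j => x j j) (NumberField.discr K)
      fun ℓ hℓ => let ⟨j, _, hj⟩ := hloc id ℓ hℓ; ⟨j, Finset.mem_univ j, hxℓ j j ℓ hℓ hj⟩
    have hTf := associated_gcd_sq_mul Finset.univ (fun j => f j ^ ((p - 1) / 2)) T
      fun ℓ hℓ => let ⟨j, hj⟩ := hcover ℓ hℓ
        ⟨j, Finset.mem_univ j, fun h => hj
          (((Nat.prime_iff_prime_int.mp hℓ).dvd_of_dvd_pow h).trans (hfg j))⟩
    simp only [hxT] at hDx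
    rcases Int.associated_iff.mp (hDx.trans hTf.symm) with h | h
    · exact h
    -- The sign is excluded because `disc K` and `T` have nonnegative square cofactors with equal
    -- products, and `f i ≠ 0`.
    · have hT0 : T ≠ 0 := by
        refine mul_ne_zero (mul_ne_zero (pow_ne_zero _ (by norm_num))
          (pow_ne_zero _ (by exact_mod_cast hp.ne_zero))) (Finset.prod_ne_zero_iff.mpr fun j _ =>
            pow_ne_zero _ (by exact_mod_cast (hq j).ne_zero))
      have h1 := hxT i
      rw [h] at h1
      have h2 : (x i i ^ 2 + (f i ^ ((p - 1) / 2)) ^ 2) * T = 0 := by linear_combination -h1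
      have hf0 : f i ≠ 0 := fun h0 => hc0 i (by rw [hf i, h0, mul_zero])
      have h3 := (mul_eq_zero.mp h2).resolve_right hT0
      have : 0 < (f i ^ ((p - 1) / 2)) ^ 2 := by positivity
      nlinarith [sq_nonneg (x i i)]
  · intro hp5
    have hlocB : LocallyLE p (ringOfIntegersSubmodule K) (intAdjoin (β i)) :=
      (hlocBG i).trans hp (locallyLE_adjoin_beta hp hodd hp5 (hγ i) rfl (hβ i) (ht i))
    obtain ⟨y, hy, hyℓ⟩ := exists_hasDiscr_of_locallyLE
      (Subalgebra.toSubmodule.monotone (hBO i)) hp hlocB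
    have hdiscG : ∀ j, ∃ z : ℤ, HasDiscr (intAdjoin (γ j)) (z ^ 2 * NumberField.discr K) ∧
        ∀ ℓ : ℕ, ℓ.Prime → LocallyLE ℓ (ringOfIntegersSubmodule K) (intAdjoin (γ j)) →
          ¬ (ℓ : ℤ) ∣ z := fun j => by
      refine exists_hasDiscr_of_locallyLE (Subalgebra.toSubmodule.monotone (hGO j)) (hq j)
        (hlocG j (q j) (hq j) ?_ (hqg j))
      exact fun h => hpa (h ▸ hqa j)
    choose z hz hzℓ using hdiscG
    refine ⟨_, _, hy, hz, ?_⟩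
    -- `none` indexes `ℤ[β_i]`, the member maximal at `p`; `some j` indexes `ℤ[γ_j]`.
    have := associated_gcd_sq_mul (Finset.univ : Finset (Option (Fin m)))
      (fun o => o.elim y z) (NumberField.discr K) fun ℓ hℓ => ?_
    · refine this.trans (Associated.of_eq (dvd_antisymm_of_normalize_eq Finset.normalize_gcd
        (normalize_gcd _ _) (dvd_gcd (Finset.gcd_dvd (Finset.mem_univ none))
          (Finset.dvd_gcd fun j _ => Finset.gcd_dvd (Finset.mem_univ (some j))))
        (Finset.dvd_gcd fun o _ => ?_)))
      cases o with
      | none => exact gcd_dvd_left _ _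
      | some j => exact (gcd_dvd_right _ _).trans (Finset.gcd_dvd (Finset.mem_univ j))
    · by_cases h : ℓ = p
      · exact ⟨none, Finset.mem_univ _, h ▸ hyℓ p hp hlocB⟩
      · obtain ⟨j, hj⟩ := hcover ℓ hℓ
        exact ⟨some j, Finset.mem_univ _, hzℓ j ℓ hℓ (hlocG j ℓ hℓ h hj)⟩
  · refine ⟨fun j => x i j ^ 2 * NumberField.discr K, fun j => ?_, ?_⟩
    · have := hx i j
      rwa [← Subalgebra.mul_toSubmodule] at this
    · exact associated_gcd_sq_mul _ _ _ fun ℓ hℓ =>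
        let ⟨j, _, hj⟩ := hloc (fun _ => i) ℓ hℓ
        ⟨j, Finset.mem_univ j, hxℓ i j ℓ hℓ hj⟩
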